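/- Let $\mathcal X\subset\mathbb R$ be an interval, let $x_o$ be an interior point of $\mathcal X$, and let $(F_x)_{x\in\mathcal X}$ be a family of distribution functions on $\mathbb R$ such that $x\mapsto F_x(y)$ is non-increasing on $\mathcal X$ for every $y\in\mathbb R$. For each $n\ge 2$ let $(X_{n1},Y_{n1}),\dots,(X_{nn},Y_{nn})$ be observations with $X_{ni}\in\mathcal X$ (random or fixed) and $Y_{ni}\in\mathbb R$ such that, conditionally on $\boldsymbol X_n=(X_{ni})_{i=1}^n$, the variables $Y_{n1},\dots,Y_{nn}$ are independent with $P(Y_{ni}\le y\mid \boldsymbol X_n)=F_{X_{ni}}(y)$ for all $i\le n$, $y\in\mathbb R$. Let $x_1<\dots<x_m$ be the distinct values among $X_{n1},\dots,X_{nn}$, put $w_j=\#\{i: X_{ni}=x_j\}$ and $\widehat{\mathbb F}_j(y)=w_j^{-1}\sum_{i:X_{ni}=x_j}1_{[Y_{ni}\le y]}$. For each $y$ let $(\widehat F_{nx_j}(y))_{j=1}^m$ be the unique minimizer of $\sum_{j=1}^m w_j(\widehat{\mathbb F}_j(y)-f_j)^2$ over all $f\in\mathbb R^m$ with $f_1\ge\dots\ge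 f_m$. Extend it to a non-increasing function $x\mapsto\widehat F_{nx}(y)$ on $\mathcal X$ with $\widehat F_{nx}(y)=\widehat F_{nx_1}(y)$ for $x\le x_1$, $\widehat F_{nx}(y)=\widehat F_{nx_m}(y)$ for $x\ge x_m$, and an arbitrary non-increasing interpolation between neighbouring $x_j$. Suppose that: (i) for a neighbourhood $U\subset\mathcal X$ of $x_o$, an interval $J\subset\mathbb R$ and constants $\alpha\in(0,1]$, $C_1>0$, $$\sup_{y\in J}|F_x(y)-F_{x_o}(y)|\le C_1|x-x_o|^\alpha\quad\text{for all }x\in U;$$ (ii) for constants $C_2,C_3>0$, with $\delta_n=C_3n^{-1/(2\alpha+1)}$ and $w_n(B)=\#\{i\le n:X_{ni}\in B\}$, the probability that both $$\frac{w_n([x_o-\delta_n,x_o])}{n\delta_n}\ge C_2\quad\text{and}\quad\frac{w_n([x_o,x_o+\delta_n])}{n\delta_n}\ge C_2$$ hold tends to $1$ as $n\to\infty$. Then $$\sup_{y\in J}\bigl|\widehat F_{nx_o}(y)-F_{x_o}(y)\bigr|=O_p\bigl(n^{-\alpha/(2\alpha+1)}\bigr),$$ that is, for every $\varepsilon>0$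 there is $M>0$ such that $P\bigl(\sup_{y\in J}|\widehat F_{nx_o}(y)-F_{x_o}(y)|>M n^{-\alpha/(2\alpha+1)}\bigr)\le\varepsilon$ for all sufficiently large $n$ (outer probability, should the interpolation make the event non-measurable). -/

import Mathlib

open MeasureTheory ProbabilityTheory Filter Topology Set
open scoped ENNReal

noncomputable section

/-- `G` is a (cumulative) distribution function of a probability distribution on the real line. -/
structure IsDistFun (G : ℝ → ℝ) : Prop where
  mono : Monotone G
  right_cont : ∀ y, ContinuousWithinAt G (Ici y) y
  lim_bot : Tendsto G atBot (𝓝 0)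
  lim_top : Tendsto G atTop (𝓝 1)

/-- The σ-algebra generated by the design vector `(X_1, …, X_n)`. -/
abbrev designSigma {Ω : Type*} {n : ℕ} (X : Fin n → Ω → ℝ) : MeasurableSpace Ω :=
  MeasurableSpace.comap (fun ω i => X i ω) MeasurableSpace.pi

/-- The observation model for one sample size `n`: random (or fixed) design points `X_i` with
values in `S`, and random responses `Y_i` that are, conditionally on `(X_1, …, X_n)`, independent
with `P(Y_i ≤ y | X_1, …, X_n) = F_{X_i}(y)` almost surely. -/
structure IsSample {Ω : Type*} [MeasurableSpace Ω] (μ : Measure Ω) (S : Set ℝ) (F : ℝ → ℝ → ℝ)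
    {n : ℕ} (X Y : Fin n → Ω → ℝ) : Prop where
  measurable_X : ∀ i, Measurable (X i)
  measurable_Y : ∀ i, Measurable (Y i)
  mem : ∀ i ω, X i ω ∈ S
  condIndep : ∀ B : Fin n → Set ℝ, (∀ i, MeasurableSet (B i)) →
    μ⟦⋂ i, Y i ⁻¹' B i | designSigma X⟧ =ᵐ[μ]
      fun ω => ∏ i, (μ⟦Y i ⁻¹' B i | designSigma X⟧) ω
  condLaw : ∀ (i : Fin n) (y : ℝ),
    μ⟦{ω | Y i ω ≤ y} | designSigma X⟧ =ᵐ[μ] fun ω => F (X i ω) y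

/-- The finite set `{x_1 < ⋯ < x_m}` of distinct values among the design points. -/
def observed {n : ℕ} (x : Fin n → ℝ) : Finset ℝ := Finset.univ.image x

/-- The number `w_n(B)` of design points in `B`. -/
def freq {n : ℕ} (x : Fin n → ℝ) (B : Set ℝ) : ℕ := {i | x i ∈ B}.ncard

/-- The empirical distribution function, at `c`, of the responses whose design point equals `t`. -/
def naiveCdf {n : ℕ} (x y : Fin n → ℝ) (t c : ℝ) : ℝ :=
  (freq x {t} : ℝ)⁻¹ * ∑ i with x i = t, if y i ≤ c then (1 : ℝ) else 0

/-- The weighted sum of squares `∑_j w_j (𝔽_j(c) - f(x_j))²` over the distinct design points. -/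
def weightedSS {n : ℕ} (x y : Fin n → ℝ) (c : ℝ) (f : ℝ → ℝ) : ℝ :=
  ∑ t ∈ observed x, (freq x {t} : ℝ) * (naiveCdf x y t c - f t) ^ 2

/-- `h t c` is a version of the monotone least squares estimator of `F_t(c)`, `t ∈ S`, for the
data `(x_i, y_i)`: for each `c`, its values at the distinct design points minimize the weighted sum
of squares among all antitonic vectors, and it is extended from there to an antitonic function
on `S` which is constant to the left of the smallest and to the right of the largest design
point. Between neighbouring design points any antitonic interpolation is allowed. -/
structure IsMonotoneLSE {n : ℕ} (S : Set ℝ) (x y : Fin n → ℝ) (h : ℝ → ℝ → ℝ) : Prop where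
  antitone : ∀ c, AntitoneOn (fun t => h t c) S
  minimal : ∀ (c : ℝ) (f : ℝ → ℝ), AntitoneOn f (observed x : Set ℝ) →
    weightedSS x y c (fun t => h t c) ≤ weightedSS x y c f
  left_const : ∀ (c : ℝ) (i : Fin n), (∀ k, x i ≤ x k) → ∀ t ∈ S, t ≤ x i → h t c = h (x i) c
  right_const : ∀ (c : ℝ) (i : Fin n), (∀ k, x k ≤ x i) → ∀ t ∈ S, x i ≤ t → h t c = h (x i) c

/-- Local Hölder condition at `xo`, uniformly over `y ∈ J`, on the neighbourhood `U` of `xo`. -/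
def LocalHolder (F : ℝ → ℝ → ℝ) (xo : ℝ) (U J : Set ℝ) (α C₁ : ℝ) : Prop :=
  ∀ x ∈ U, ∀ y ∈ J, |F x y - F xo y| ≤ C₁ * |x - xo| ^ α

/-- The bandwidth `δ_n = C₃ n^{-1/(2α+1)}`. -/
def bandwidth (α C₃ : ℝ) (n : ℕ) : ℝ := C₃ * (n : ℝ) ^ (-1 / (2 * α + 1))

/-- The event that both `[xo - δ_n, xo]` and `[xo, xo + δ_n]` carry at least `C₂ n δ_n` design
points. -/
def denseEvent {Ω : Type*} {n : ℕ} (X : Fin n → Ω → ℝ) (xo α C₂ C₃ : ℝ) : Set Ω :=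
  {ω | C₂ ≤ (freq (fun i => X i ω) (Icc (xo - bandwidth α C₃ n) xo) : ℝ)
          / (n * bandwidth α C₃ n) ∧
       C₂ ≤ (freq (fun i => X i ω) (Icc xo (xo + bandwidth α C₃ n)) : ℝ)
          / (n * bandwidth α C₃ n)}

/-- `Z_n = O_p(r_n)` for `[0, ∞]`-valued `Z_n`, each on its own probability space: for each `ε > 0`
there is a constant `M` with `P(Z_n > M r_n) ≤ ε` for all large `n`. (For a non-measurable event,
the measure is the outer measure.) -/
def IsBigOInProb {Ω : ℕ → Type*} [∀ n, MeasurableSpace (Ω n)] (μ : ∀ n, Measure (Ω n))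
    (Z : ∀ n, Ω n → ℝ≥0∞) (r : ℕ → ℝ) : Prop :=
  ∀ ε : ℝ, 0 < ε → ∃ M : ℝ, 0 < M ∧ ∀ᶠ n in atTop,
    μ n {ω | ENNReal.ofReal (M * r n) < Z n ω} ≤ ENNReal.ofReal ε

end

/-! Only upper and lower bounds at `xo` are needed, and they mirror each other. Put `u = xo - δ`.
Optimality bounds the fit at `xo` by the mean response over a block of design points running from
`u` to some data-dependent point, a block that contains all design points in `[u, xo]`
(`IsMonotoneLSE.exists_block_ge`). Every point of the block lies to the right of `u`, so by
monotonicity in the covariate the mean of the true values is at most `F u c`, however far the block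
reaches. The bias is therefore at most `C₁ * δ ^ α`.

The noise must be controlled uniformly over the right endpoint of the block and over the threshold
`c`. A Hájek–Rényi inequality (`pi_exists_block_average_le`) does this: blocks with at least `L`
points have centred mean at most `η`, up to probability of order `1 / (η ^ 2 * L)`. With `L` of
order `n * δ` and `η` a multiple of the rate, this probability is constant in `n` and small for a
large multiple.

That inequality is a dyadic union bound over `pi_exists_partial_sum_le`, which reduces to random
signs by symmetrization. For signs, Lévy's inequality is used twice
(`card_exists_rademacher_quadrant`): along the covariate in a sup-norm space, then along the
responses. No chaining or entropy is needed. The bounds hold for each fixed design and are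
integrated over the design by `IsSample.measure_le_of_forall`. -/

noncomputable section

/-- The sign `±1` encoded by a Boolean. -/
def boolSign (b : Bool) : ℝ := if b then 1 else -1

@[simp] lemma boolSign_not (b : Bool) : boolSign (!b) = -boolSign b := by
  cases b <;> simp [boolSign]

lemma boolSign_mul_self (b : Bool) : boolSign b * boolSign b = 1 := by
  cases b <;> simp [boolSign]

/-! ### Maximal inequalities for random signs -/

section Rademacher

open scoped Classical

variable {ι : Type*} [Fintype ι]

/-- Lévy's maximal inequality for Rademacher sums in a normed space, the partial sums being taken
along the preorder induced by `x`, in the form of a count of signs. -/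
lemma card_exists_partial_sum_le {E : Type*} [NormedAddCommGroup E] [NormedSpace ℝ E]
    (x : ι → ℝ) (z : ι → E) (t : ℝ) :
    (Finset.univ.filter fun s : ι → Bool =>
      ∃ k, t < ‖∑ i with x i ≤ x k, boolSign (s i) • z i‖).card ≤
    2 * (Finset.univ.filter fun s : ι → Bool => t < ‖∑ i, boolSign (s i) • z i‖).card := by
  set P : (ι → Bool) → ι → Prop := fun s k => t < ‖∑ i with x i ≤ x k, boolSign (s i) • z i‖
    with hP
  set A := Finset.univ.filter fun s : ι → Bool => ∃ k, P s k with hA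
  set T := Finset.univ.filter fun s : ι → Bool => t < ‖∑ i, boolSign (s i) • z i‖ with hT
  have hmin : ∀ s : ι → Bool, ∃ k : Option ι, s ∈ A → ∃ k', k = some k' ∧ P s k' ∧
      ∀ j, P s j → x k' ≤ x j := by
    intro s
    by_cases hs : s ∈ A
    · obtain ⟨k0, hk0⟩ := (Finset.mem_filter.1 hs).2
      obtain ⟨k, hk, hk'⟩ := Finset.exists_min_image (Finset.univ.filter (P s)) x
        ⟨k0, by simpa using hk0⟩
      refine ⟨some k, fun _ => ⟨k, rfl, by simpa using hk, fun j hj => hk' j (by simpa using hj)⟩⟩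
    · exact ⟨none, fun h => absurd h hs⟩
  choose κ hκ using hmin
  -- Reflection: keep the signs up to the first exceedance and flip all later ones. The two full
  -- sums add up to twice the exceeding partial sum, so one of them exceeds `t` as well.
  let φ : (ι → Bool) → (ι → Bool) := fun s i =>
    match κ s with
    | none => s i
    | some k => if x i ≤ x k then s i else !(s i)
  have hφ : ∀ s ∈ A, ∃ k, κ s = some k ∧ P s k ∧ (∀ j, P s j → x k ≤ x j) ∧
      ∀ i, φ s i = if x i ≤ x k then s i else !(s i) := by
    intro s hs
    obtain ⟨k, hk, h1, h2⟩ := hκ s hs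
    exact ⟨k, hk, h1, h2, fun i => by simp [φ, hk]⟩
  have hPeq : ∀ s s' : ι → Bool, ∀ k j, (∀ i, x i ≤ x k → s' i = s i) → x j ≤ x k →
      (P s' j ↔ P s j) := by
    intro s s' k j h hj
    have : ∑ i with x i ≤ x j, boolSign (s' i) • z i = ∑ i with x i ≤ x j, boolSign (s i) • z i :=
      Finset.sum_congr rfl fun i hi => by
        rw [h i ((Finset.mem_filter.1 hi).2.trans hj)]
    simp only [hP, this]
  have hinv : ∀ s ∈ A, φ (φ s) = s := by
    intro s hs
    obtain ⟨k, -, hk1, hk2, hk3⟩ := hφ s hs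
    have hag : ∀ i, x i ≤ x k → φ s i = s i := fun i hi => by rw [hk3, if_pos hi]
    have hs' : φ s ∈ A := by
      simp only [hA, Finset.mem_filter, Finset.mem_univ, true_and]
      exact ⟨k, (hPeq s (φ s) k k hag le_rfl).2 hk1⟩
    -- Ties in `x` may make `k'` differ from `k`, but `φ` depends only on the value `x k`, and
    -- minimality on both sides makes the two values equal.
    obtain ⟨k', -, hk1', hk2', hk3'⟩ := hφ (φ s) hs'
    have h1 : x k' ≤ x k := hk2' k ((hPeq s (φ s) k k hag le_rfl).2 hk1)
    have h2 : x k ≤ x k' := hk2 k' ((hPeq s (φ s) k k' hag h1).1 hk1')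
    funext i
    rw [hk3', hk3, le_antisymm h1 h2]
    split_ifs <;> simp
  have hinj : Set.InjOn φ A := fun a ha b hb hab => by
    rw [← hinv a ha, ← hinv b hb, hab]
  have hsub : A ⊆ T ∪ (A.filter fun s => φ s ∈ T) := by
    intro s hs
    obtain ⟨k, -, hk1, -, hk3⟩ := hφ s hs
    have hsum : (∑ i, boolSign (s i) • z i) + ∑ i, boolSign (φ s i) • z i =
        (2 : ℝ) • ∑ i with x i ≤ x k, boolSign (s i) • z i := by
      rw [← Finset.sum_add_distrib, Finset.smul_sum, Finset.sum_filter]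
      refine Finset.sum_congr rfl fun i _ => ?_
      rw [hk3]
      split_ifs
      · rw [two_smul]
      · simp
    by_contra hcon
    simp only [hT, Finset.mem_union, Finset.mem_filter, Finset.mem_univ, true_and, hs, not_or,
      not_lt] at hcon
    have h1 := norm_add_le (∑ i, boolSign (s i) • z i) (∑ i, boolSign (φ s i) • z i)
    rw [hsum, norm_smul, Real.norm_ofNat] at h1
    simp only [hP] at hk1
    linarith [hcon.1, hcon.2]
  calc A.card ≤ (T ∪ (A.filter fun s => φ s ∈ T)).card := Finset.card_le_card hsub
    _ ≤ T.card + (A.filter fun s => φ s ∈ T).card := Finset.card_union_le _ _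
    _ ≤ T.card + T.card := by
        refine Nat.add_le_add_left ?_ _
        refine Finset.card_le_card_of_injOn φ ?_ ?_
        · intro s hs
          simpa using (Finset.mem_filter.1 hs).2
        · exact hinj.mono fun s hs => (Finset.mem_filter.1 hs).1
    _ = 2 * T.card := by ring

/-- Flipping the single sign `s i` is a fixed-point-free involution that negates the summand. -/
lemma sum_boolSign_mul_eq_zero {i j : ι} (hij : i ≠ j) :
    ∑ s : ι → Bool, boolSign (s i) * boolSign (s j) = 0 := by
  refine Finset.sum_ninvolution (fun s => Function.update s i (!(s i))) ?_ ?_ ?_ ?_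
  · intro s
    simp [Function.update_of_ne hij.symm]
  · intro s _ h
    have := congrFun h i
    simp at this
  · simp
  · intro s
    simp

lemma sum_sq_rademacher (a : ι → ℝ) :
    ∑ s : ι → Bool, (∑ i, boolSign (s i) * a i) ^ 2 = 2 ^ Fintype.card ι * ∑ i, a i ^ 2 := by
  have h1 : ∀ s : ι → Bool, (∑ i, boolSign (s i) * a i) ^ 2 =
      ∑ i, ∑ j, (boolSign (s i) * boolSign (s j)) * (a i * a j) := by
    intro s
    rw [sq, Finset.sum_mul_sum]
    exact Finset.sum_congr rfl fun i _ => Finset.sum_congr rfl fun j _ => by ring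
  simp_rw [h1]
  rw [Finset.sum_comm, Finset.mul_sum]
  refine Finset.sum_congr rfl fun i _ => ?_
  rw [Finset.sum_comm, Finset.sum_eq_single i]
  · simp only [boolSign_mul_self, one_mul, Finset.sum_const, Finset.card_univ, Fintype.card_fun,
      Fintype.card_bool, nsmul_eq_mul, Nat.cast_pow, Nat.cast_ofNat]
    ring
  · intro j _ hj
    rw [← Finset.sum_mul, sum_boolSign_mul_eq_zero hj.symm, zero_mul]
  · simp

lemma card_rademacher_chebyshev (a : ι → ℝ) {t : ℝ} (ht : 0 ≤ t) :
    ((Finset.univ.filter fun s : ι → Bool => t < ‖∑ i, boolSign (s i) • a i‖).card : ℝ) * t ^ 2 ≤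
      2 ^ Fintype.card ι * ∑ i, a i ^ 2 := by
  rw [← sum_sq_rademacher, ← nsmul_eq_mul, ← Finset.sum_const]
  refine (Finset.sum_le_sum fun s hs => ?_).trans
    (Finset.sum_le_sum_of_subset_of_nonneg (Finset.filter_subset _ _) fun s _ _ => sq_nonneg _)
  have h := (Finset.mem_filter.1 hs).2
  simp only [smul_eq_mul] at h
  rw [← sq_abs (∑ i, _)]
  exact pow_le_pow_left₀ ht h.le 2

/-- A two-parameter maximal inequality for Rademacher sums over `I ∩ {x ≤ v, y ≤ c}`. -/
lemma card_exists_rademacher_quadrant (x y : ι → ℝ) (I : Finset ι) {t : ℝ} (ht : 0 ≤ t) :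
    ((Finset.univ.filter fun s : ι → Bool =>
      ∃ (k : ι) (c : ℝ), t < |∑ i ∈ I with x i ≤ x k, boolSign (s i) *
        if y i ≤ c then 1 else 0|).card : ℝ) * t ^ 2 ≤ 4 * (2 ^ Fintype.card ι * I.card) := by
  -- The coordinates of `z` are the thresholds `y j`, so the sup norm of a partial sum is the
  -- maximum over observed thresholds, and the vector-valued Lévy inequality disposes of the
  -- `x`-direction.
  let z : ι → (ι → ℝ) := fun i j => if i ∈ I ∧ y i ≤ y j then 1 else 0
  let a : ι → ℝ := fun i => if i ∈ I then 1 else 0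
  have h1 := card_exists_partial_sum_le x z t
  have h2 := card_exists_partial_sum_le y a t
  have h3 := card_rademacher_chebyshev a ht
  have ha : ∑ i, a i ^ 2 = I.card := by simp [a]
  rw [ha] at h3
  have hsub1 : (Finset.univ.filter fun s : ι → Bool =>
      ∃ (k : ι) (c : ℝ), t < |∑ i ∈ I with x i ≤ x k, boolSign (s i) *
        if y i ≤ c then 1 else 0|) ⊆ (Finset.univ.filter fun s : ι → Bool =>
      ∃ k, t < ‖∑ i with x i ≤ x k, boolSign (s i) • z i‖) := by
    intro s hs
    obtain ⟨k, c, hkc⟩ := (Finset.mem_filter.1 hs).2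
    refine Finset.mem_filter.2 ⟨Finset.mem_univ _, k, ?_⟩
    -- A real threshold `c` acts like the largest `y j ≤ c`; below all data the sum is empty of ones
    -- and cannot exceed `t ≥ 0`.
    by_cases hc : ∃ i, y i ≤ c
    · obtain ⟨i0, hi0⟩ := hc
      obtain ⟨j, hj, hj'⟩ := Finset.exists_max_image (Finset.univ.filter fun i => y i ≤ c) y
        ⟨i0, by simpa using hi0⟩
      simp only [Finset.mem_filter, Finset.mem_univ, true_and] at hj hj'
      refine hkc.trans_le (le_trans (le_of_eq ?_) (norm_le_pi_norm _ j))
      rw [Real.norm_eq_abs, Finset.sum_apply]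
      congr 1
      calc ∑ i ∈ I with x i ≤ x k, boolSign (s i) * (if y i ≤ c then 1 else 0)
          = ∑ i ∈ I with x i ≤ x k, (boolSign (s i) • z i) j := by
            refine Finset.sum_congr rfl fun i hi => ?_
            have hy : y i ≤ c ↔ y i ≤ y j := ⟨hj' i, fun h => h.trans hj⟩
            simp [z, (Finset.mem_filter.1 hi).1, hy]
        _ = ∑ i with x i ≤ x k, (boolSign (s i) • z i) j := by
            refine Finset.sum_subset (Finset.filter_subset_filter _ (Finset.subset_univ _)) ?_
            intro i hi hi'
            have : i ∉ I := fun h => hi' (Finset.mem_filter.2 ⟨h, (Finset.mem_filter.1 hi).2⟩)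
            simp [z, this]
    · push Not at hc
      exfalso
      rw [Finset.sum_eq_zero (fun i _ => by simp [not_le.2 (hc i)]), abs_zero] at hkc
      linarith
  -- Coordinate `j` of the full sum is itself a partial sum along the order of `y`, so the scalar
  -- Lévy inequality applies.
  have hsub2 : (Finset.univ.filter fun s : ι → Bool => t < ‖∑ i, boolSign (s i) • z i‖) ⊆
      (Finset.univ.filter fun s : ι → Bool =>
      ∃ k, t < ‖∑ i with y i ≤ y k, boolSign (s i) • a i‖) := by
    intro s hs
    refine Finset.mem_filter.2 ⟨Finset.mem_univ _, ?_⟩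
    by_contra hcon
    push Not at hcon
    refine absurd (Finset.mem_filter.1 hs).2 (not_lt.2 ((pi_norm_le_iff_of_nonneg ht).2 ?_))
    intro j
    refine le_trans (le_of_eq (congrArg _ ?_)) (hcon j)
    rw [Finset.sum_apply, Finset.sum_filter]
    refine Finset.sum_congr rfl fun i _ => ?_
    by_cases hi : i ∈ I <;> by_cases hy : y i ≤ y j <;> simp [z, a, hi, hy]
  have h4 := (Finset.card_le_card hsub1).trans
    (h1.trans (Nat.mul_le_mul_left 2 ((Finset.card_le_card hsub2).trans h2)))
  have h5 := mul_le_mul_of_nonneg_right (Nat.cast_le (α := ℝ).2 h4) (sq_nonneg t)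
  push_cast at h5
  linarith

end Rademacher

end

/-! ### Symmetrization and the Hájek–Rényi inequality -/

noncomputable section

section Symmetrization

open scoped Classical

variable {ι : Type*} [Fintype ι]

/-- If the difference exceeds `t / 2`, one of the two samples exceeds `t / 4`; hence the constant `2
* 4 * 16 = 128`. -/
lemma card_exists_rademacher_diff (x y y' : ι → ℝ) (I : Finset ι) {t : ℝ} (ht : 0 ≤ t) :
    ((Finset.univ.filter fun s : ι → Bool =>
      ∃ (k : ι) (c : ℚ), t / 2 < |∑ i ∈ I with x i ≤ x k, boolSign (s i) *
        ((if y i ≤ c then 1 else 0) - if y' i ≤ c then 1 else 0)|).card : ℝ) * t ^ 2 ≤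
      128 * (2 ^ Fintype.card ι * I.card) := by
  have h1 := card_exists_rademacher_quadrant x y I (t := t / 4) (by positivity)
  have h2 := card_exists_rademacher_quadrant x y' I (t := t / 4) (by positivity)
  have hsub : (Finset.univ.filter fun s : ι → Bool =>
      ∃ (k : ι) (c : ℚ), t / 2 < |∑ i ∈ I with x i ≤ x k, boolSign (s i) *
        ((if y i ≤ c then 1 else 0) - if y' i ≤ c then 1 else 0)|) ⊆
      (Finset.univ.filter fun s : ι → Bool =>
        ∃ (k : ι) (c : ℝ), t / 4 < |∑ i ∈ I with x i ≤ x k, boolSign (s i) *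
          if y i ≤ c then 1 else 0|) ∪
      (Finset.univ.filter fun s : ι → Bool =>
        ∃ (k : ι) (c : ℝ), t / 4 < |∑ i ∈ I with x i ≤ x k, boolSign (s i) *
          if y' i ≤ c then 1 else 0|) := by
    intro s hs
    obtain ⟨k, c, hkc⟩ := (Finset.mem_filter.1 hs).2
    simp_rw [mul_sub] at hkc
    rw [Finset.sum_sub_distrib] at hkc
    simp only [Finset.mem_union, Finset.mem_filter, Finset.mem_univ, true_and]
    by_contra hcon
    push Not at hcon
    have := abs_sub (∑ i ∈ I with x i ≤ x k, boolSign (s i) * if y i ≤ c then (1 : ℝ) else 0)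
      (∑ i ∈ I with x i ≤ x k, boolSign (s i) * if y' i ≤ c then (1 : ℝ) else 0)
    linarith [hcon.1 k c, hcon.2 k c]
  have h3 := (Nat.cast_le (α := ℝ).2 ((Finset.card_le_card hsub).trans (Finset.card_union_le _ _)))
  push_cast at h3
  have h4 := mul_le_mul_of_nonneg_right h3 (sq_nonneg t)
  linarith

/-- Exchanging the coordinates of `p.1` and `p.2` selected by `s`. -/
def swapCoords (s : ι → Bool) (p : (ι → ℝ) × (ι → ℝ)) : (ι → ℝ) × (ι → ℝ) :=
  (fun i => if s i then p.1 i else p.2 i, fun i => if s i then p.2 i else p.1 i)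

/-- The sample and its independent copy are regrouped into independent pairs, and each pair is
exchangeable because both entries have law `ν i`. -/
lemma measurePreserving_swapCoords (ν : ι → Measure ℝ) [∀ i, IsProbabilityMeasure (ν i)]
    (s : ι → Bool) :
    MeasurePreserving (swapCoords s) ((Measure.pi ν).prod (Measure.pi ν))
      ((Measure.pi ν).prod (Measure.pi ν)) := by
  have h1 := measurePreserving_arrowProdEquivProdArrow ℝ ℝ ι ν ν
  have h2 : MeasurePreserving
      (fun (a : ι → ℝ × ℝ) i => (fun q : ℝ × ℝ => if s i then q else q.swap) (a i))
      (Measure.pi fun i => (ν i).prod (ν i)) (Measure.pi fun i => (ν i).prod (ν i)) := by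
    refine measurePreserving_pi _ _ (f := fun i (q : ℝ × ℝ) => if s i then q else q.swap) fun i => ?_
    cases hs : s i
    · simpa using Measure.measurePreserving_swap
    · simpa using! MeasurePreserving.id _
  have h3 := h1.comp (h2.comp (h1.symm _))
  convert h3 using 1
  funext p
  ext i <;> simp [swapCoords, MeasurableEquiv.arrowProdEquivProdArrow,
    Equiv.arrowProdEquivProdArrow] <;> cases s i <;> simp

/-- Chebyshev's inequality for a sum of independent centred indicators. -/
lemma pi_chebyshev (ν : ι → Measure ℝ) [∀ i, IsProbabilityMeasure (ν i)] (I : Finset ι) (c : ℝ)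
    {t : ℝ} (ht : 0 < t) :
    Measure.pi ν {y | t ≤ |∑ i ∈ I, ((if y i ≤ c then 1 else 0) - (ν i).real (Iic c))|} ≤
      ENNReal.ofReal (I.card / t ^ 2) := by
  -- Extending by zero off `I` allows the variance formula for the full product; each variance is at
  -- most `1 / 4`.
  let g : ι → ℝ → ℝ := fun i r => if i ∈ I then (Iic c).indicator 1 r else 0
  have hgm : ∀ i, Measurable (g i) := fun i => by
    by_cases hi : i ∈ I
    · simpa [g, hi] using measurable_one.indicator measurableSet_Iic
    · simp [g, hi]
  have hg01 : ∀ i r, g i r ∈ Icc (0 : ℝ) 1 := fun i r => by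
    by_cases hi : i ∈ I <;> by_cases hr : r ≤ c <;> simp [g, hi, hr, indicator]
  have hg2 : ∀ i, MemLp (g i) 2 (ν i) := fun i =>
    MemLp.of_bound (hgm i).aestronglyMeasurable 1 (ae_of_all _ fun r => by
      rw [Real.norm_eq_abs, abs_of_nonneg (hg01 i r).1]; exact (hg01 i r).2)
  have hvar := variance_sum_pi (μ := ν) hg2
  have hvar' : Var[∑ i, fun ω : ι → ℝ => g i (ω i); Measure.pi ν] ≤ I.card := by
    rw [hvar, ← Finset.sum_filter_add_sum_filter_not Finset.univ (fun i => i ∈ I)]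
    rw [Finset.sum_eq_zero (s := Finset.univ.filter fun i => i ∉ I), add_zero]
    · refine (Finset.sum_le_card_nsmul _ _ 1 fun i _ => ?_).trans (by simp)
      refine (variance_le_sq_of_bounded (ae_of_all _ (hg01 i)) (hgm i).aemeasurable).trans ?_
      norm_num
    · intro i hi
      have : g i = 0 := by
        funext r
        simp [g, (Finset.mem_filter.1 hi).2]
      rw [this, variance_zero]
  have hL : MemLp (∑ i, fun ω : ι → ℝ => g i (ω i)) 2 (Measure.pi ν) :=
    memLp_finsetSum' _ fun i _ => (hg2 i).comp_measurePreserving (measurePreserving_eval ν i)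
  have hmean : (Measure.pi ν)[∑ i, fun ω : ι → ℝ => g i (ω i)] = ∑ i ∈ I, (ν i).real (Iic c) := by
    simp only [Finset.sum_apply]
    rw [integral_finsetSum]
    · rw [← Finset.sum_filter_add_sum_filter_not Finset.univ (fun i => i ∈ I),
        Finset.sum_eq_zero (s := Finset.univ.filter fun i => i ∉ I), add_zero]
      · rw [Finset.filter_mem_eq_inter, Finset.univ_inter]
        refine Finset.sum_congr rfl fun i hi => ?_
        have := integral_comp_eval (μ := ν) (i := i) (f := g i) (hgm i).aestronglyMeasurable
        rw [this]
        simp only [g, hi, if_true]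
        rw [integral_indicator_one measurableSet_Iic]
      · intro i hi
        simp [g, (Finset.mem_filter.1 hi).2]
    · intro i _
      exact ((hg2 i).comp_measurePreserving (measurePreserving_eval ν i)).integrable (by norm_num)
  have h := meas_ge_le_variance_div_sq hL ht
  rw [hmean] at h
  refine le_trans (le_of_eq ?_) (h.trans (ENNReal.ofReal_le_ofReal (by gcongr)))
  congr 1
  ext y
  simp only [mem_ofPred_eq, Finset.sum_apply]
  rw [Finset.sum_sub_distrib]
  have : ∑ i, g i (y i) = ∑ i ∈ I, if y i ≤ c then (1 : ℝ) else 0 := by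
    rw [← Finset.sum_subset (Finset.subset_univ I)]
    · exact Finset.sum_congr rfl fun i hi => by simp [g, hi, indicator]
    · intro i _ hi
      simp [g, hi]
  rw [this]

lemma measurable_indicator_le {α : Type*} [MeasurableSpace α] {f : α → ℝ} (hf : Measurable f)
    (c : ℝ) : Measurable fun a => if f a ≤ c then (1 : ℝ) else 0 :=
  Measurable.ite (measurableSet_le hf measurable_const) measurable_const measurable_const

/-- Maximal inequality for the centred sequential empirical process of independent, not
necessarily identically distributed variables. -/
lemma pi_exists_partial_sum_le (ν : ι → Measure ℝ) [∀ i, IsProbabilityMeasure (ν i)] (x : ι → ℝ)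
    (I : Finset ι) {t : ℝ} (ht : 0 < t) :
    Measure.pi ν {y | ∃ (k : ι) (c : ℚ), t < |∑ i ∈ I with x i ≤ x k,
      ((if y i ≤ c then 1 else 0) - (ν i).real (Iic (c : ℝ)))|} ≤
      ENNReal.ofReal (256 * I.card / t ^ 2) := by
  set A : Set (ι → ℝ) := {y | ∃ (k : ι) (c : ℚ), t < |∑ i ∈ I with x i ≤ x k,
      ((if y i ≤ c then 1 else 0) - (ν i).real (Iic (c : ℝ)))|} with hA
  -- In this case the claimed bound exceeds `1`. Otherwise Chebyshev at level `t / 2` leaves the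
  -- independent copy small with probability at least `1 / 2`.
  by_cases hbig : t ^ 2 < 8 * I.card
  · refine prob_le_one.trans ?_
    rw [← ENNReal.ofReal_one]
    refine ENNReal.ofReal_le_ofReal ?_
    rw [le_div_iff₀ (by positivity)]
    linarith [sq_nonneg t]
  push Not at hbig
  let D : (ι → Bool) → Set ((ι → ℝ) × (ι → ℝ)) := fun s => {p | ∃ (k : ι) (c : ℚ),
    t / 2 < |∑ i ∈ I with x i ≤ x k, boolSign (s i) *
        ((if p.1 i ≤ c then 1 else 0) - if p.2 i ≤ c then 1 else 0)|}
  have hDm : ∀ s, MeasurableSet (D s) := by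
    intro s
    have : D s = ⋃ (k : ι) (c : ℚ), {p | t / 2 < |∑ i ∈ I with x i ≤ x k, boolSign (s i) *
        ((if p.1 i ≤ (c : ℝ) then 1 else 0) - if p.2 i ≤ (c : ℝ) then 1 else 0)|} := by
      ext p; simp only [D, mem_iUnion, mem_ofPred_eq]
    rw [this]
    refine MeasurableSet.iUnion fun k => MeasurableSet.iUnion fun c =>
      measurableSet_lt measurable_const ?_
    refine Measurable.abs (Finset.measurable_sum _ fun i _ => measurable_const.mul
      (Measurable.sub ?_ ?_))
    · exact measurable_indicator_le ((measurable_pi_apply i).comp measurable_fst) _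
    · exact measurable_indicator_le ((measurable_pi_apply i).comp measurable_snd) _
  let s1 : ι → Bool := fun _ => true
  set π := Measure.pi ν with hπ
  have hAm : MeasurableSet A := by
    have : A = ⋃ (k : ι) (c : ℚ), {y | t < |∑ i ∈ I with x i ≤ x k,
      ((if y i ≤ (c : ℝ) then 1 else 0) - (ν i).real (Iic (c : ℝ)))|} := by
      ext p; simp only [hA, mem_iUnion, mem_ofPred_eq]
    rw [this]
    refine MeasurableSet.iUnion fun k => MeasurableSet.iUnion fun c =>
      measurableSet_lt measurable_const ?_
    refine Measurable.abs (Finset.measurable_sum _ fun i _ =>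
      (measurable_indicator_le (measurable_pi_apply i) _).sub measurable_const)
  -- desymmetrization
  have hsec : ∀ y ∈ A, (2⁻¹ : ℝ≥0∞) ≤ π (Prod.mk y ⁻¹' D s1) := by
    rintro y ⟨k, c, hkc⟩
    have hch := pi_chebyshev ν (I.filter fun i => x i ≤ x k) c (half_pos ht)
    have hle : ENNReal.ofReal ((I.filter fun i => x i ≤ x k).card / (t / 2) ^ 2) ≤ 2⁻¹ := by
      rw [show (2⁻¹ : ℝ≥0∞) = ENNReal.ofReal 2⁻¹ by
        rw [ENNReal.ofReal_inv_of_pos two_pos]; simp]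
      refine ENNReal.ofReal_le_ofReal ?_
      rw [div_le_iff₀ (by positivity)]
      have : ((I.filter fun i => x i ≤ x k).card : ℝ) ≤ I.card :=
        Nat.cast_le.2 (Finset.card_filter_le _ _)
      linarith
    set Bad := {y' : ι → ℝ | t / 2 ≤ |∑ i ∈ I with x i ≤ x k,
      ((if y' i ≤ c then 1 else 0) - (ν i).real (Iic (c : ℝ)))|}
    have hsub : Badᶜ ⊆ Prod.mk y ⁻¹' D s1 := by
      intro y' hy'
      simp only [Bad, mem_compl_iff, mem_ofPred_eq, not_le] at hy'
      refine ⟨k, c, ?_⟩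
      have heq : ∑ i ∈ I with x i ≤ x k, boolSign (s1 i) *
          ((if (y, y').1 i ≤ c then (1 : ℝ) else 0) - if (y, y').2 i ≤ c then 1 else 0) =
          (∑ i ∈ I with x i ≤ x k, ((if y i ≤ c then 1 else 0) - (ν i).real (Iic (c : ℝ)))) -
          ∑ i ∈ I with x i ≤ x k, ((if y' i ≤ c then 1 else 0) - (ν i).real (Iic (c : ℝ))) := by
        rw [← Finset.sum_sub_distrib]
        refine Finset.sum_congr rfl fun i _ => ?_
        simp [s1, boolSign]
      rw [heq]
      have := abs_sub_abs_le_abs_sub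
        (∑ i ∈ I with x i ≤ x k, ((if y i ≤ c then 1 else 0) - (ν i).real (Iic (c : ℝ))))
        (∑ i ∈ I with x i ≤ x k, ((if y' i ≤ c then 1 else 0) - (ν i).real (Iic (c : ℝ))))
      linarith
    have h1 : (1 : ℝ≥0∞) ≤ π Bad + π Badᶜ := by
      rw [← measure_univ (μ := π), ← union_compl_self Bad]
      exact measure_union_le _ _
    have h2 : (1 : ℝ≥0∞) ≤ 2⁻¹ + π Badᶜ := h1.trans (by gcongr; exact hch.trans hle)
    refine le_trans ?_ (measure_mono hsub)
    rw [← ENNReal.inv_two_add_inv_two] at h2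
    exact (ENNReal.add_le_add_iff_left (by simp)).1 h2
  have hfub : 2⁻¹ * π A ≤ (π.prod π) (D s1) := by
    rw [Measure.prod_apply (hDm s1), ← setLIntegral_const]
    exact (setLIntegral_mono' hAm hsec).trans (setLIntegral_le_lintegral _ _)
  -- randomization of the signs
  have hinv : ∀ s, (π.prod π) (D s) = (π.prod π) (D s1) := by
    -- Swapping the pair at the indices where `s` is false negates exactly those differences.
    intro s
    rw [← (measurePreserving_swapCoords ν s).measure_preimage (hDm s1).nullMeasurableSet]
    congr 1
    ext p
    simp only [D, mem_ofPred_eq, mem_preimage, swapCoords, s1]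
    refine exists_congr fun k => exists_congr fun c => ?_
    rw [iff_iff_eq]
    congr 2
    refine Finset.sum_congr rfl fun i _ => ?_
    by_cases h : s i = true <;> simp [boolSign, h]
  have hsum : (2 ^ Fintype.card ι : ℝ≥0∞) * (π.prod π) (D s1) ≤
      ENNReal.ofReal (128 * (2 ^ Fintype.card ι * I.card) / t ^ 2) := by
    calc (2 ^ Fintype.card ι : ℝ≥0∞) * (π.prod π) (D s1)
        = ∑ s : ι → Bool, (π.prod π) (D s) := by
          simp_rw [hinv]
          simp
      _ = ∑ s : ι → Bool, ∫⁻ p, (D s).indicator 1 p ∂(π.prod π) := by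
          simp_rw [lintegral_indicator_one (hDm _)]
      _ = ∫⁻ p, ∑ s : ι → Bool, (D s).indicator 1 p ∂(π.prod π) :=
          (lintegral_finsetSum _ fun s _ => measurable_one.indicator (hDm s)).symm
      _ ≤ ∫⁻ p, ENNReal.ofReal (128 * (2 ^ Fintype.card ι * I.card) / t ^ 2) ∂(π.prod π) := by
          refine lintegral_mono fun p => ?_
          have h := card_exists_rademacher_diff x p.1 p.2 I ht.le
          rw [← le_div_iff₀ (by positivity)] at h
          refine le_trans (le_of_eq ?_) (ENNReal.ofReal_le_ofReal h)
          rw [ENNReal.ofReal_natCast, Finset.card_eq_sum_ones, Finset.sum_filter, Nat.cast_sum]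
          refine Finset.sum_congr rfl fun s _ => ?_
          simp [indicator, D]
      _ = _ := by simp
  have h2pos : (2 ^ Fintype.card ι : ℝ≥0∞) ≠ 0 := by positivity
  have h2top : (2 ^ Fintype.card ι : ℝ≥0∞) ≠ ⊤ := by simp
  have hfin : (π.prod π) (D s1) ≤ ENNReal.ofReal (128 * I.card / t ^ 2) := by
    rw [← ENNReal.mul_le_mul_iff_right h2pos h2top]
    refine hsum.trans (le_of_eq ?_)
    rw [show (2 ^ Fintype.card ι : ℝ≥0∞) = ENNReal.ofReal (2 ^ Fintype.card ι) by
      rw [ENNReal.ofReal_pow zero_le_two]; simp, ← ENNReal.ofReal_mul (by positivity)]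
    congr 1
    ring
  have h3 : π A ≤ 2 * (π.prod π) (D s1) := by
    calc π A = 2 * (2⁻¹ * π A) := by
          rw [← mul_assoc, ENNReal.mul_inv_cancel (by simp) (by simp), one_mul]
      _ ≤ _ := by gcongr
  refine h3.trans ((mul_le_mul_right hfin 2).trans (le_of_eq ?_))
  rw [show (2 : ℝ≥0∞) = ENNReal.ofReal 2 by simp, ← ENNReal.ofReal_mul (by positivity)]
  congr 1
  ring

/-- A Hájek–Rényi type inequality: uniform control of the averages over the blocks
`{i | u ≤ x i ≤ x k}` containing at least `L` points. -/
lemma pi_exists_block_average_le (ν : ι → Measure ℝ) [∀ i, IsProbabilityMeasure (ν i)]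
    (x : ι → ℝ) (u : ℝ) {L η : ℝ} (hL : 0 < L) (hη : 0 < η) :
    Measure.pi ν {y | ∃ (k : ι) (c : ℚ),
      L ≤ (Finset.univ.filter fun i => u ≤ x i ∧ x i ≤ x k).card ∧
      η * (Finset.univ.filter fun i => u ≤ x i ∧ x i ≤ x k).card <
        |∑ i with u ≤ x i ∧ x i ≤ x k,
          ((if y i ≤ c then 1 else 0) - (ν i).real (Iic (c : ℝ)))|} ≤
      ENNReal.ofReal (1024 / (η ^ 2 * L)) := by
  set N : ι → ℕ := fun k => (Finset.univ.filter fun i => u ≤ x i ∧ x i ≤ x k).card with hN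
  have hNmono : ∀ i k, x i ≤ x k → N i ≤ N k := fun i k hik =>
    Finset.card_le_card fun j hj => by
      simp only [Finset.mem_filter, Finset.mem_univ, true_and] at hj ⊢
      exact ⟨hj.1, hj.2.trans hik⟩
  -- Since `N` is monotone along `x`, `I l` is an initial segment of the points right of `u`. Every
  -- block with fewer than `2 ^ (l + 1) * L` points is a partial sum inside it.
  let I : ℕ → Finset ι := fun l => Finset.univ.filter fun i => u ≤ x i ∧ (N i : ℝ) < 2 ^ (l + 1) * L
  have hIcard : ∀ l, ((I l).card : ℝ) ≤ 2 ^ (l + 1) * L := by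
    intro l
    rcases (I l).eq_empty_or_nonempty with h | h
    · rw [h]; simp; positivity
    · obtain ⟨k, hk, hk'⟩ := Finset.exists_max_image (I l) x h
      have : (I l).card ≤ N k := Finset.card_le_card fun j hj => by
        simp only [Finset.mem_filter, Finset.mem_univ, true_and]
        exact ⟨(Finset.mem_filter.1 hj).2.1, hk' j hj⟩
      exact (Nat.cast_le.2 this).trans (Finset.mem_filter.1 hk).2.2.le
  set E : ℕ → Set (ι → ℝ) := fun l => {y | ∃ (k : ι) (c : ℚ), η * (2 ^ l * L) <
    |∑ i ∈ I l with x i ≤ x k, ((if y i ≤ c then 1 else 0) - (ν i).real (Iic (c : ℝ)))|}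
  have hEl : ∀ l, Measure.pi ν (E l) ≤ ENNReal.ofReal (512 / (η ^ 2 * L) * (1 / 2) ^ l) := by
    intro l
    refine (pi_exists_partial_sum_le ν x (I l) (by positivity)).trans
      (ENNReal.ofReal_le_ofReal ?_)
    calc 256 * ((I l).card : ℝ) / (η * (2 ^ l * L)) ^ 2
        ≤ 256 * (2 ^ (l + 1) * L) / (η * (2 ^ l * L)) ^ 2 := by gcongr; exact hIcard l
      _ = _ := by
        rw [one_div_pow]
        field_simp
        ring
  refine (measure_mono (t := ⋃ l, E l) ?_).trans ((measure_iUnion_le _).trans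
    ((ENNReal.tsum_le_tsum hEl).trans (le_of_eq ?_)))
  · rintro y ⟨k, c, hk1, hk2⟩
    have hone : 1 ≤ (N k : ℝ) / L := by rwa [le_div_iff₀ hL, one_mul]
    obtain ⟨l, hl1, hl2⟩ := exists_nat_pow_near hone (one_lt_two)
    rw [le_div_iff₀ hL] at hl1
    rw [div_lt_iff₀ hL] at hl2
    refine mem_iUnion.2 ⟨l, k, c, ?_⟩
    have hset : (I l).filter (fun i => x i ≤ x k) =
        Finset.univ.filter fun i => u ≤ x i ∧ x i ≤ x k := by
      ext i
      simp only [I, Finset.mem_filter, Finset.mem_univ, true_and]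
      refine ⟨fun h => ⟨h.1.1, h.2⟩, fun h => ⟨⟨h.1, lt_of_le_of_lt ?_ hl2⟩, h.2⟩⟩
      exact Nat.cast_le.2 (hNmono i k h.2)
    rw [hset]
    exact (mul_le_mul_of_nonneg_left hl1 hη.le).trans_lt hk2
  · rw [← ENNReal.ofReal_tsum_of_nonneg (fun l => by positivity)
      (summable_geometric_two.mul_left _), tsum_mul_left, tsum_geometric_two]
    congr 1
    ring

end Symmetrization

end

/-! ### The conditional law of the responses -/

noncomputable section

/-- The probability measure on the line with distribution function `G`. -/
def IsDistFun.measure {G : ℝ → ℝ} (hG : IsDistFun G) : Measure ℝ :=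
  (⟨G, hG.mono, hG.right_cont⟩ : StieltjesFunction ℝ).measure

instance {G : ℝ → ℝ} (hG : IsDistFun G) : IsProbabilityMeasure hG.measure :=
  StieltjesFunction.isProbabilityMeasure _ hG.lim_bot hG.lim_top

lemma IsDistFun.measure_Iic {G : ℝ → ℝ} (hG : IsDistFun G) (y : ℝ) :
    hG.measure (Iic y) = ENNReal.ofReal (G y) := by
  rw [IsDistFun.measure, StieltjesFunction.measure_Iic _ hG.lim_bot, sub_zero]

lemma IsDistFun.nonneg {G : ℝ → ℝ} (hG : IsDistFun G) (y : ℝ) : 0 ≤ G y :=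
  hG.mono.le_of_tendsto hG.lim_bot y

lemma IsDistFun.real_Iic {G : ℝ → ℝ} (hG : IsDistFun G) (y : ℝ) :
    hG.measure.real (Iic y) = G y := by
  rw [measureReal_def, hG.measure_Iic, ENNReal.toReal_ofReal (hG.nonneg y)]

lemma isCountablySpanning_Iic : IsCountablySpanning (range (Iic : ℝ → Set ℝ)) := by
  refine ⟨fun n : ℕ => Iic (n : ℝ), fun n => mem_range_self _, ?_⟩
  refine eq_univ_of_forall fun r => ?_
  obtain ⟨n, hn⟩ := exists_nat_ge r
  exact mem_iUnion.2 ⟨n, hn⟩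

lemma generateFrom_pi_Iic {ι : Type*} [Finite ι] :
    (MeasurableSpace.pi : MeasurableSpace (ι → ℝ)) =
      MeasurableSpace.generateFrom (pi univ '' pi univ fun _ : ι => range (Iic : ℝ → Set ℝ)) := by
  refine (generateFrom_eq_pi (fun _ => ?_) fun _ => isCountablySpanning_Iic).symm
  rw [← borel_eq_generateFrom_Iic, BorelSpace.measurable_eq (α := ℝ)]

lemma isPiSystem_pi_Iic {ι : Type*} :
    IsPiSystem (pi univ '' pi univ fun _ : ι => range (Iic : ℝ → Set ℝ)) :=
  IsPiSystem.pi fun _ => isPiSystem_Iic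

section Kernel

variable {G : ℝ → ℝ → ℝ}

/-- The law of independent responses with distribution functions `G (x i)`. -/
def responseMeasure (hG : ∀ t, IsDistFun (G t)) {n : ℕ} (x : Fin n → ℝ) : Measure (Fin n → ℝ) :=
  Measure.pi fun i => (hG (x i)).measure

instance (hG : ∀ t, IsDistFun (G t)) {n : ℕ} (x : Fin n → ℝ) :
    IsProbabilityMeasure (responseMeasure hG x) := by
  unfold responseMeasure; infer_instance

lemma responseMeasure_pi_Iic (hG : ∀ t, IsDistFun (G t)) {n : ℕ} (x c : Fin n → ℝ) :
    responseMeasure hG x (pi univ fun i => Iic (c i)) = ENNReal.ofReal (∏ i, G (x i) (c i)) := by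
  rw [responseMeasure, Measure.pi_pi, ENNReal.ofReal_prod_of_nonneg fun i _ => (hG _).nonneg _]
  exact Finset.prod_congr rfl fun i _ => (hG (x i)).measure_Iic (c i)

lemma measurable_responseMeasure (hG : ∀ t, IsDistFun (G t))
    (hGm : ∀ y, Measurable fun t => G t y) (n : ℕ) :
    Measurable (responseMeasure hG (n := n)) := by
  refine Measurable.measure_of_isPiSystem_of_isProbabilityMeasure generateFrom_pi_Iic
    isPiSystem_pi_Iic ?_
  rintro _ ⟨B, hB, rfl⟩
  choose c hc using fun i => hB i (mem_univ i)
  obtain rfl : (fun i => Iic (c i)) = B := funext hc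
  simp_rw [responseMeasure_pi_Iic]
  exact ENNReal.measurable_ofReal.comp
    (Finset.measurable_prod _ fun i _ => (hGm (c i)).comp (measurable_pi_apply i))

/-- The conditional law of the responses given the design points, as a Markov kernel. -/
def responseKernel (hG : ∀ t, IsDistFun (G t)) (hGm : ∀ y, Measurable fun t => G t y) (n : ℕ) :
    Kernel (Fin n → ℝ) (Fin n → ℝ) :=
  ⟨responseMeasure hG, measurable_responseMeasure hG hGm n⟩

instance (hG : ∀ t, IsDistFun (G t)) (hGm : ∀ y, Measurable fun t => G t y) (n : ℕ) :
    IsMarkovKernel (responseKernel hG hGm n) :=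
  ⟨fun x => inferInstanceAs (IsProbabilityMeasure (responseMeasure hG x))⟩

variable {Ω : Type*} [MeasurableSpace Ω] {μ : Measure Ω} [IsProbabilityMeasure μ] {S : Set ℝ}
  {F : ℝ → ℝ → ℝ} {n : ℕ} {X Y : Fin n → Ω → ℝ}

/-- On products of half-lines the conditional probability is the product of the `G (X i ω) (c i)`;
integrating it over a design event gives the identity. Such boxes form a π-system that determines
the joint law. -/
lemma IsSample.measure_inter_Iic (h : IsSample μ S F X Y) (hG : ∀ t, IsDistFun (G t))
    (hGm : ∀ y, Measurable fun t => G t y) (hFG : ∀ t ∈ S, F t = G t)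
    {A : Set (Fin n → ℝ)} (hA : MeasurableSet A) (c : Fin n → ℝ) :
    μ ((fun ω i => X i ω) ⁻¹' A ∩ (fun ω i => Y i ω) ⁻¹' (pi univ fun i => Iic (c i))) =
      ∫⁻ x in A, responseMeasure hG x (pi univ fun i => Iic (c i))
        ∂(μ.map fun ω i => X i ω) := by
  have hX : Measurable fun ω i => X i ω := measurable_pi_lambda _ h.measurable_X
  have hm : designSigma X ≤ ‹MeasurableSpace Ω› := hX.comap_le
  set V : Set Ω := ⋂ i, Y i ⁻¹' Iic (c i) with hV
  have hVm : MeasurableSet V := MeasurableSet.iInter fun i => h.measurable_Y i measurableSet_Iic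
  have hVeq : (fun ω i => Y i ω) ⁻¹' (pi univ fun i => Iic (c i)) = V := by
    ext ω; simp [hV, Pi.le_def]
  have hcond : μ⟦V | designSigma X⟧ =ᵐ[μ] fun ω => ∏ i, G (X i ω) (c i) := by
    have h1 := h.condIndep (fun i => Iic (c i)) fun i => measurableSet_Iic
    have h2 : ∀ᵐ ω ∂μ, ∀ i, (μ⟦{ω | Y i ω ≤ c i} | designSigma X⟧) ω = F (X i ω) (c i) :=
      ae_all_iff.2 fun i => h.condLaw i (c i)
    filter_upwards [h1, h2] with ω hω1 hω2
    rw [hω1]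
    refine Finset.prod_congr rfl fun i _ => ?_
    rw [← hFG _ (h.mem i ω), ← hω2 i]
    rfl
  have hAX : MeasurableSet[designSigma X] ((fun ω i => X i ω) ⁻¹' A) := ⟨A, hA, rfl⟩
  have hint : ∫ ω in (fun ω i => X i ω) ⁻¹' A, ∏ i, G (X i ω) (c i) ∂μ =
      μ.real ((fun ω i => X i ω) ⁻¹' A ∩ V) := by
    rw [← setIntegral_congr_ae (hm _ hAX) (hcond.mono fun ω hω _ => hω),
      setIntegral_condExp hm ((integrable_const (1 : ℝ)).indicator hVm) hAX,
      setIntegral_indicator hVm]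
    simp
  have hint' : Integrable (fun ω => ∏ i, G (X i ω) (c i)) μ := integrable_condExp.congr hcond
  have hmeas : Measurable fun x => responseMeasure hG x (pi univ fun i => Iic (c i)) :=
    (Measure.measurable_coe (MeasurableSet.univ_pi fun i => measurableSet_Iic)).comp
      (measurable_responseMeasure hG hGm n)
  rw [hVeq, setLIntegral_map hA hmeas hX]
  simp_rw [responseMeasure_pi_Iic]
  rw [← ofReal_integral_eq_lintegral_ofReal hint'.integrableOn
    (ae_of_all _ fun ω => Finset.prod_nonneg fun i _ => (hG _).nonneg _), hint,
    ofReal_measureReal]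

/-- The joint law of design points and responses. -/
lemma IsSample.map_eq_compProd (h : IsSample μ S F X Y) (hG : ∀ t, IsDistFun (G t))
    (hGm : ∀ y, Measurable fun t => G t y) (hFG : ∀ t ∈ S, F t = G t) :
    μ.map (fun ω => ((fun i => X i ω), fun i => Y i ω)) =
      (μ.map fun ω i => X i ω) ⊗ₘ responseKernel hG hGm n := by
  have hX : Measurable fun ω i => X i ω := measurable_pi_lambda _ h.measurable_X
  have hY : Measurable fun ω i => Y i ω := measurable_pi_lambda _ h.measurable_Y
  have : IsProbabilityMeasure (μ.map fun ω i => X i ω) :=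
    Measure.isProbabilityMeasure_map hX.aemeasurable
  have : IsProbabilityMeasure (μ.map (fun ω => ((fun i => X i ω), fun i => Y i ω))) :=
    Measure.isProbabilityMeasure_map (hX.prodMk hY).aemeasurable
  refine Measure.ext_prod fun {A B} hA hB => ?_
  let m1 : Measure (Fin n → ℝ) := (μ.restrict ((fun ω i => X i ω) ⁻¹' A)).map fun ω i => Y i ω
  let m2 : Measure (Fin n → ℝ) :=
    ((μ.map fun ω i => X i ω).restrict A).bind (responseKernel hG hGm n)
  have hm1 : ∀ {B}, MeasurableSet B →
      m1 B = μ ((fun ω i => X i ω) ⁻¹' A ∩ (fun ω i => Y i ω) ⁻¹' B) := by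
    intro B hB
    rw [Measure.map_apply hY hB, Measure.restrict_apply (hY hB), inter_comm]
  have hm2 : ∀ {B}, MeasurableSet B →
      m2 B = ∫⁻ x in A, responseMeasure hG x B ∂(μ.map fun ω i => X i ω) := by
    intro B hB
    exact Measure.bind_apply hB (responseKernel hG hGm n).aemeasurable
  have h12 : m1 = m2 := by
    have : IsFiniteMeasure m1 := by infer_instance
    refine ext_of_generate_finite _ generateFrom_pi_Iic isPiSystem_pi_Iic ?_ ?_
    · rintro _ ⟨B, hB, rfl⟩
      choose c hc using fun i => hB i (mem_univ i)
      obtain rfl : (fun i => Iic (c i)) = B := funext hc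
      have hmeas := MeasurableSet.univ_pi fun i => measurableSet_Iic (a := c i)
      rw [hm1 hmeas, hm2 hmeas]
      exact h.measure_inter_Iic hG hGm hFG hA c
    · rw [hm1 .univ, hm2 .univ]
      simp [Measure.map_apply hX hA]
  rw [Measure.map_apply (hX.prodMk hY) (hA.prod hB), Measure.compProd_apply_prod hA hB]
  have := hm2 hB
  rw [← h12, hm1 hB] at this
  exact this

/-- An event with conditional probability at most `b` for every design has probability at most
`b`. -/
lemma IsSample.measure_le_of_forall (h : IsSample μ S F X Y) (hG : ∀ t, IsDistFun (G t))
    (hGm : ∀ y, Measurable fun t => G t y) (hFG : ∀ t ∈ S, F t = G t)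
    {A : Set ((Fin n → ℝ) × (Fin n → ℝ))} (hA : MeasurableSet A) {b : ℝ≥0∞}
    (hb : ∀ x, responseMeasure hG x (Prod.mk x ⁻¹' A) ≤ b) :
    μ {ω | ((fun i => X i ω), fun i => Y i ω) ∈ A} ≤ b := by
  have hX : Measurable fun ω i => X i ω := measurable_pi_lambda _ h.measurable_X
  have hY : Measurable fun ω i => Y i ω := measurable_pi_lambda _ h.measurable_Y
  have : IsProbabilityMeasure (μ.map fun ω i => X i ω) :=
    Measure.isProbabilityMeasure_map hX.aemeasurable
  have h1 := Measure.map_apply (μ := μ) (hX.prodMk hY) hA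
  rw [h.map_eq_compProd hG hGm hFG, Measure.compProd_apply hA] at h1
  refine h1.symm.le.trans ((lintegral_mono hb).trans ?_)
  simp

end Kernel

end

/-! ### Characterizing the least squares fit -/

noncomputable section

section LeastSquares

variable {n : ℕ}

lemma freq_eq_card (x : Fin n → ℝ) (B : Set ℝ) [DecidablePred (· ∈ B)] :
    freq x B = (Finset.univ.filter fun i => x i ∈ B).card := by
  rw [freq, Set.ncard_eq_toFinset_card']
  congr 1
  ext i
  simp

lemma sum_observed_freq (x : Fin n → ℝ) (P : ℝ → Prop) [DecidablePred P] :
    ∑ t ∈ observed x with P t, (freq x {t} : ℝ) = (Finset.univ.filter fun i => P (x i)).card := by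
  rw [Finset.card_eq_sum_ones, Nat.cast_sum, Finset.sum_filter, Finset.sum_filter, observed,
    Finset.sum_image']
  intro i _
  rw [freq_eq_card, ← Finset.sum_filter, Finset.filter_filter]
  split_ifs with h
  · rw [Finset.sum_congr (Finset.filter_congr fun j _ => show (x j = x i ∧ P (x j)) ↔
      x j ∈ ({x i} : Set ℝ) from ⟨fun hj => hj.1, fun hj => ⟨hj, by rw [mem_singleton_iff.1 hj]; exact h⟩⟩)
      fun _ _ => rfl]
    simp
  · rw [Finset.sum_eq_zero]
    intro j hj
    have := (Finset.mem_filter.1 hj).2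
    exact absurd (this.1 ▸ this.2) h

lemma freq_mul_naiveCdf (x y : Fin n → ℝ) (i : Fin n) (c : ℝ) :
    (freq x {x i} : ℝ) * naiveCdf x y (x i) c =
      ∑ j with x j = x i, if y j ≤ c then (1 : ℝ) else 0 := by
  have : (freq x {x i} : ℝ) ≠ 0 := by
    rw [freq_eq_card, Nat.cast_ne_zero]
    exact Finset.card_ne_zero_of_mem (a := i) (by simp)
  rw [naiveCdf, mul_inv_cancel_left₀ this]

/-- The weights cancel the normalization of `naiveCdf`, turning sums over distinct design values
into sums over observations. -/
lemma sum_observed_freq_mul_naiveCdf (x y : Fin n → ℝ) (c : ℝ) (P : ℝ → Prop) [DecidablePred P] :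
    ∑ t ∈ observed x with P t, (freq x {t} : ℝ) * naiveCdf x y t c =
      ∑ i with P (x i), if y i ≤ c then (1 : ℝ) else 0 := by
  rw [Finset.sum_filter, Finset.sum_filter, observed, Finset.sum_image']
  intro i _
  rw [freq_mul_naiveCdf]
  split_ifs with h
  · refine Finset.sum_congr rfl fun j hj => ?_
    exact (if_pos (by rw [(Finset.mem_filter.1 hj).2]; exact h)).symm
  · rw [Finset.sum_eq_zero]
    intro j hj
    rw [if_neg]
    rw [(Finset.mem_filter.1 hj).2]
    exact h

lemma exists_pos_le_of_pos {β : Type*} (T : Finset β) (g : β → ℝ) :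
    ∃ e : ℝ, 0 < e ∧ ∀ t ∈ T, 0 < g t → e ≤ g t := by
  rcases (T.filter fun t => 0 < g t).eq_empty_or_nonempty with h | h
  · refine ⟨1, one_pos, fun t ht h0 => ?_⟩
    have : t ∈ T.filter fun t => 0 < g t := Finset.mem_filter.2 ⟨ht, h0⟩
    simp [h] at this
  · obtain ⟨t0, h0, h1⟩ := Finset.exists_min_image _ g h
    exact ⟨g t0, (Finset.mem_filter.1 h0).2, fun t ht hp => h1 t (Finset.mem_filter.2 ⟨ht, hp⟩)⟩

/-- The first order condition for a weighted least squares fit in an admissible direction. -/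
lemma sum_residual_nonpos_of_minimal (T : Finset ℝ) (w v h : ℝ → ℝ) (P : ℝ → Prop) [DecidablePred P] (s : ℝ)
    (e : ℝ) (he : 0 < e)
    (hmin : ∀ d, 0 < d → d ≤ e → ∑ t ∈ T, w t * (v t - h t) ^ 2 ≤
      ∑ t ∈ T, w t * (v t - (h t + if P t then s * d else 0)) ^ 2) :
    s * ∑ t ∈ T with P t, w t * (v t - h t) ≤ 0 := by
  set R := ∑ t ∈ T with P t, w t * (v t - h t)
  set W := ∑ t ∈ T with P t, w t
  have hd : ∀ d, 0 < d → d ≤ e → 2 * (s * R) ≤ d * (s ^ 2 * W) := by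
    intro d hd0 hde
    have h1 := hmin d hd0 hde
    have h2 : ∑ t ∈ T, w t * (v t - (h t + if P t then s * d else 0)) ^ 2 =
        ∑ t ∈ T, w t * (v t - h t) ^ 2 + (d ^ 2 * (s ^ 2 * W) - 2 * d * (s * R)) := by
      simp only [R, W, Finset.sum_filter, Finset.mul_sum]
      rw [← Finset.sum_sub_distrib, ← Finset.sum_add_distrib]
      refine Finset.sum_congr rfl fun t _ => ?_
      split_ifs <;> ring
    rw [h2] at h1
    have h3 : d * (2 * (s * R)) ≤ d * (d * (s ^ 2 * W)) := by linarith
    exact le_of_mul_le_mul_left h3 hd0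
  by_contra hcon
  push Not at hcon
  have hW : 0 < s ^ 2 * W := by
    by_contra hW
    push Not at hW
    have := hd e he le_rfl
    nlinarith
  -- This step size makes the quadratic term at most `s * R`, contradicting `2 * (s * R) ≤ d * (s ^
  -- 2 * W)`.
  have h1 := hd (min e (s * R / (s ^ 2 * W))) (lt_min he (div_pos hcon hW)) (min_le_left _ _)
  have h2 : min e (s * R / (s ^ 2 * W)) * (s ^ 2 * W) ≤ s * R := by
    rw [← le_div_iff₀ hW]; exact min_le_right _ _
  linarith

variable {S : Set ℝ} {x y : Fin n → ℝ} {h : ℝ → ℝ → ℝ}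

lemma antitoneOn_observed (H : IsMonotoneLSE S x y h) (hx : ∀ i, x i ∈ S) (c : ℝ) :
    AntitoneOn (fun t => h t c) (observed x : Set ℝ) := by
  refine (H.antitone c).mono fun t ht => ?_
  obtain ⟨i, -, rfl⟩ := Finset.mem_image.1 (Finset.mem_coe.1 ht)
  exact hx i

/-- Lowering the fit slightly on the upper level set to the right of `u` stays antitone: the step
`e` does not exceed the gap between `θ` and the fitted values below it. The first order condition
then gives a nonnegative residual sum on this set, where the fit is at least `θ`. -/
lemma IsMonotoneLSE.sum_le (H : IsMonotoneLSE S x y h) (hx : ∀ i, x i ∈ S) (c u θ : ℝ) :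
    θ * (Finset.univ.filter fun i => u ≤ x i ∧ θ ≤ h (x i) c).card ≤
      ∑ i with u ≤ x i ∧ θ ≤ h (x i) c, if y i ≤ c then (1 : ℝ) else 0 := by
  have hanti := antitoneOn_observed H hx c
  obtain ⟨e, he, he'⟩ := exists_pos_le_of_pos (observed x) fun t => θ - h t c
  have key := sum_residual_nonpos_of_minimal (observed x) (fun t => (freq x {t} : ℝ))
    (fun t => naiveCdf x y t c) (fun t => h t c) (fun t => u ≤ t ∧ θ ≤ h t c) (-1) e he fun d hd0 hde => by
      refine H.minimal c (fun t => h t c + if u ≤ t ∧ θ ≤ h t c then -1 * d else 0) ?_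
      intro t ht t' ht' htt'
      have h1 : h t' c ≤ h t c := hanti ht ht' htt'
      by_cases hP : u ≤ t ∧ θ ≤ h t c <;> by_cases hP' : u ≤ t' ∧ θ ≤ h t' c <;> simp only [hP, hP', and_self, if_true, if_false]
      · linarith
      · have h2 : h t' c < θ := by
          by_contra hcon
          exact hP' ⟨hP.1.trans htt', not_lt.1 hcon⟩
        have := he' t' ht' (sub_pos.2 h2)
        linarith [hP.2]
      · linarith
      · linarith
  simp only [mul_sub] at key
  rw [Finset.sum_sub_distrib, sum_observed_freq_mul_naiveCdf x y c (fun t => u ≤ t ∧ θ ≤ h t c)] at key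
  have h3 : θ * (Finset.univ.filter fun i => u ≤ (x i) ∧ θ ≤ h (x i) c).card ≤
      ∑ t ∈ observed x with u ≤ t ∧ θ ≤ h t c, (freq x {t} : ℝ) * h t c := by
    rw [← sum_observed_freq x (fun t => u ≤ t ∧ θ ≤ h t c), Finset.mul_sum]
    refine Finset.sum_le_sum fun t ht => ?_
    rw [mul_comm]
    exact mul_le_mul_of_nonneg_left (Finset.mem_filter.1 ht).2.2 (Nat.cast_nonneg _)
  linarith

/-- Mirror image: the fit is raised on the lower level set to the left of `u`. -/
lemma IsMonotoneLSE.le_sum (H : IsMonotoneLSE S x y h) (hx : ∀ i, x i ∈ S) (c u θ : ℝ) :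
    ∑ i with x i ≤ u ∧ h (x i) c ≤ θ, (if y i ≤ c then (1 : ℝ) else 0) ≤
      θ * (Finset.univ.filter fun i => x i ≤ u ∧ h (x i) c ≤ θ).card := by
  have hanti := antitoneOn_observed H hx c
  obtain ⟨e, he, he'⟩ := exists_pos_le_of_pos (observed x) fun t => h t c - θ
  have key := sum_residual_nonpos_of_minimal (observed x) (fun t => (freq x {t} : ℝ))
    (fun t => naiveCdf x y t c) (fun t => h t c) (fun t => t ≤ u ∧ h t c ≤ θ) 1 e he fun d hd0 hde => by
      refine H.minimal c (fun t => h t c + if t ≤ u ∧ h t c ≤ θ then 1 * d else 0) ?_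
      intro t ht t' ht' htt'
      have h1 : h t' c ≤ h t c := hanti ht ht' htt'
      by_cases hP : t ≤ u ∧ h t c ≤ θ <;> by_cases hP' : t' ≤ u ∧ h t' c ≤ θ <;> simp only [hP, hP', and_self, if_true, if_false]
      · linarith
      · linarith
      · have h2 : θ < h t c := by
          by_contra hcon
          exact hP ⟨htt'.trans hP'.1, not_lt.1 hcon⟩
        have := he' t ht (sub_pos.2 h2)
        linarith [hP'.2]
      · linarith
  simp only [mul_sub] at key
  rw [Finset.sum_sub_distrib, sum_observed_freq_mul_naiveCdf x y c (fun t => t ≤ u ∧ h t c ≤ θ)] at key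
  have h3 : ∑ t ∈ observed x with t ≤ u ∧ h t c ≤ θ, (freq x {t} : ℝ) * h t c ≤
      θ * (Finset.univ.filter fun i => (x i) ≤ u ∧ h (x i) c ≤ θ).card := by
    rw [← sum_observed_freq x (fun t => t ≤ u ∧ h t c ≤ θ), Finset.mul_sum]
    refine Finset.sum_le_sum fun t ht => ?_
    rw [mul_comm θ]
    exact mul_le_mul_of_nonneg_left (Finset.mem_filter.1 ht).2.2 (Nat.cast_nonneg _)
  linarith

/-- The fit at `xo` is at most the mean of the responses over some block `[u, x k]` that
contains all design points in `[u, xo]`. -/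
lemma IsMonotoneLSE.exists_block_ge (H : IsMonotoneLSE S x y h) (hx : ∀ i, x i ∈ S) {xo : ℝ}
    (hxo : xo ∈ S) (c u : ℝ) (hne : ∃ i, x i ∈ Icc u xo) :
    ∃ k, freq x (Icc u xo) ≤ (Finset.univ.filter fun i => u ≤ x i ∧ x i ≤ x k).card ∧
      h xo c * (Finset.univ.filter fun i => u ≤ x i ∧ x i ≤ x k).card ≤
        ∑ i with u ≤ x i ∧ x i ≤ x k, if y i ≤ c then (1 : ℝ) else 0 := by
  have hmem : ∀ i, x i ∈ Icc u xo → u ≤ x i ∧ h xo c ≤ h (x i) c := fun i hi =>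
    ⟨hi.1, H.antitone c (hx i) hxo hi.2⟩
  obtain ⟨i0, hi0⟩ := hne
  obtain ⟨k, hk, hk'⟩ := Finset.exists_max_image
    (Finset.univ.filter fun i => u ≤ x i ∧ h xo c ≤ h (x i) c) x
    ⟨i0, by simpa using hmem i0 hi0⟩
  simp only [Finset.mem_filter, Finset.mem_univ, true_and] at hk hk'
  have hset : (Finset.univ.filter fun i => u ≤ x i ∧ h xo c ≤ h (x i) c) =
      Finset.univ.filter fun i => u ≤ x i ∧ x i ≤ x k :=
    Finset.filter_congr fun i _ => ⟨fun hi => ⟨hi.1, hk' i hi⟩,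
      fun hi => ⟨hi.1, hk.2.trans (H.antitone c (hx i) (hx k) hi.2)⟩⟩
  refine ⟨k, ?_, ?_⟩
  · rw [freq_eq_card, ← hset]
    exact Finset.card_le_card fun i hi => by
      simpa using hmem i (Finset.mem_filter.1 hi).2
  · have := H.sum_le hx c u (h xo c)
    rwa [hset] at this

/-- The fit at `xo` is at least the mean of the responses over some block `[x k, u]` that
contains all design points in `[xo, u]`. -/
lemma IsMonotoneLSE.exists_block_le (H : IsMonotoneLSE S x y h) (hx : ∀ i, x i ∈ S) {xo : ℝ}
    (hxo : xo ∈ S) (c u : ℝ) (hne : ∃ i, x i ∈ Icc xo u) :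
    ∃ k, freq x (Icc xo u) ≤ (Finset.univ.filter fun i => -u ≤ -x i ∧ -x i ≤ -x k).card ∧
      ∑ i with -u ≤ -x i ∧ -x i ≤ -x k, (if y i ≤ c then (1 : ℝ) else 0) ≤
      h xo c * (Finset.univ.filter fun i => -u ≤ -x i ∧ -x i ≤ -x k).card := by
  -- The negated form of the statement makes left-running blocks an instance of the same deviation
  -- bound, with the covariate reflected.
  simp only [neg_le_neg_iff]
  have hmem : ∀ i, x i ∈ Icc xo u → x i ≤ u ∧ h (x i) c ≤ h xo c := fun i hi =>
    ⟨hi.2, H.antitone c hxo (hx i) hi.1⟩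
  obtain ⟨i0, hi0⟩ := hne
  obtain ⟨k, hk, hk'⟩ := Finset.exists_min_image
    (Finset.univ.filter fun i => x i ≤ u ∧ h (x i) c ≤ h xo c) x
    ⟨i0, by simpa using hmem i0 hi0⟩
  simp only [Finset.mem_filter, Finset.mem_univ, true_and] at hk hk'
  have hset : (Finset.univ.filter fun i => x i ≤ u ∧ h (x i) c ≤ h xo c) =
      Finset.univ.filter fun i => x i ≤ u ∧ x k ≤ x i :=
    Finset.filter_congr fun i _ => ⟨fun hi => ⟨hi.1, hk' i hi⟩,
      fun hi => ⟨hi.1, (H.antitone c (hx k) (hx i) hi.2).trans hk.2⟩⟩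
  refine ⟨k, ?_, ?_⟩
  · rw [freq_eq_card, ← hset]
    exact Finset.card_le_card fun i hi => by
      simpa using hmem i (Finset.mem_filter.1 hi).2
  · have := H.le_sum hx c u (h xo c)
    rwa [hset] at this

end LeastSquares

end

/-! ### Deviation events and deterministic error bounds -/

noncomputable section

section Deviation

variable {n : ℕ} {G : ℝ → ℝ → ℝ}

/-- The event that some block `{i | u ≤ τ (x i) ≤ τ (x k)}` with at least `L` design points has
a mean of centred indicators `1_[y i ≤ c] - G (x i) c` exceeding `η`. -/
def blockDeviation (n : ℕ) (G : ℝ → ℝ → ℝ) (τ : ℝ → ℝ) (u L η : ℝ) :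
    Set ((Fin n → ℝ) × (Fin n → ℝ)) :=
  {p | ∃ (k : Fin n) (c : ℚ),
    L ≤ (Finset.univ.filter fun i => u ≤ τ (p.1 i) ∧ τ (p.1 i) ≤ τ (p.1 k)).card ∧
    η * (Finset.univ.filter fun i => u ≤ τ (p.1 i) ∧ τ (p.1 i) ≤ τ (p.1 k)).card <
      |∑ i with u ≤ τ (p.1 i) ∧ τ (p.1 i) ≤ τ (p.1 k),
        ((if p.2 i ≤ c then 1 else 0) - G (p.1 i) c)|}

lemma measurableSet_blockDeviation (hGm : ∀ y, Measurable fun t => G t y) {τ : ℝ → ℝ}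
    (hτ : Measurable τ) (u L η : ℝ) : MeasurableSet (blockDeviation n G τ u L η) := by
  have hfst : ∀ i, Measurable fun p : (Fin n → ℝ) × (Fin n → ℝ) => p.1 i := fun i =>
    (measurable_pi_apply i).comp measurable_fst
  have hsnd : ∀ i, Measurable fun p : (Fin n → ℝ) × (Fin n → ℝ) => p.2 i := fun i =>
    (measurable_pi_apply i).comp measurable_snd
  have hset : ∀ k i, MeasurableSet {p : (Fin n → ℝ) × (Fin n → ℝ) |
      u ≤ τ (p.1 i) ∧ τ (p.1 i) ≤ τ (p.1 k)} := fun k i =>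
    (measurableSet_le measurable_const (hτ.comp (hfst i))).inter
      (measurableSet_le (hτ.comp (hfst i)) (hτ.comp (hfst k)))
  have hcard : ∀ k, Measurable fun p : (Fin n → ℝ) × (Fin n → ℝ) =>
      ((Finset.univ.filter fun i => u ≤ τ (p.1 i) ∧ τ (p.1 i) ≤ τ (p.1 k)).card : ℝ) := by
    intro k
    simp_rw [Finset.card_eq_sum_ones, Nat.cast_sum, Finset.sum_filter]
    exact Finset.measurable_sum _ fun i _ =>
      Measurable.ite (hset k i) measurable_const measurable_const
  have hsum : ∀ k (c : ℚ), Measurable fun p : (Fin n → ℝ) × (Fin n → ℝ) =>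
      ∑ i with u ≤ τ (p.1 i) ∧ τ (p.1 i) ≤ τ (p.1 k),
        ((if p.2 i ≤ c then 1 else 0) - G (p.1 i) c) := by
    intro k c
    simp_rw [Finset.sum_filter]
    exact Finset.measurable_sum _ fun i _ => Measurable.ite (hset k i)
      ((measurable_indicator_le (hsnd i) c).sub ((hGm c).comp (hfst i))) measurable_const
  have heq : blockDeviation n G τ u L η = ⋃ (k : Fin n) (c : ℚ),
    ({p | L ≤ (Finset.univ.filter fun i => u ≤ τ (p.1 i) ∧ τ (p.1 i) ≤ τ (p.1 k)).card} ∩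
    {p | η * (Finset.univ.filter fun i => u ≤ τ (p.1 i) ∧ τ (p.1 i) ≤ τ (p.1 k)).card <
      |∑ i with u ≤ τ (p.1 i) ∧ τ (p.1 i) ≤ τ (p.1 k),
        ((if p.2 i ≤ (c : ℝ) then 1 else 0) - G (p.1 i) c)|}) := by
    ext p
    simp only [blockDeviation, mem_iUnion, mem_inter_iff, mem_ofPred_eq]
  rw [heq]
  exact MeasurableSet.iUnion fun k => MeasurableSet.iUnion fun c =>
    (measurableSet_le measurable_const (hcard k)).inter
      (measurableSet_lt ((hcard k).const_mul η) (hsum k c).abs)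

lemma responseMeasure_blockDeviation_le (hG : ∀ t, IsDistFun (G t)) (τ : ℝ → ℝ) (u : ℝ)
    {L η : ℝ} (hL : 0 < L) (hη : 0 < η) (x : Fin n → ℝ) :
    responseMeasure hG x (Prod.mk x ⁻¹' blockDeviation n G τ u L η) ≤
      ENNReal.ofReal (1024 / (η ^ 2 * L)) := by
  have h := pi_exists_block_average_le (fun i => (hG (x i)).measure) (fun i => τ (x i)) u hL hη
  simp only [IsDistFun.real_Iic] at h
  exact h

lemma continuousWithinAt_indicator_le (r c : ℝ) :
    ContinuousWithinAt (fun c => if r ≤ c then (1 : ℝ) else 0) (Ici c) c := by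
  rcases le_or_gt r c with h | h
  · refine (continuousWithinAt_const (b := (1 : ℝ))).congr (fun d hd => ?_) (if_pos h)
    exact if_pos (h.trans hd)
  · refine ContinuousAt.continuousWithinAt ?_
    refine (continuousAt_const (y := (0 : ℝ))).congr ?_
    filter_upwards [Iio_mem_nhds h] with d hd
    exact (if_neg (not_le.2 hd)).symm

/-- Outside the deviation event, the bound holds at all real thresholds. -/
lemma abs_sum_le_of_notMem_blockDeviation (hG : ∀ t, IsDistFun (G t)) {τ : ℝ → ℝ} {u L η : ℝ}
    {x y : Fin n → ℝ} (h : (x, y) ∉ blockDeviation n G τ u L η) (k : Fin n)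
    (hk : L ≤ (Finset.univ.filter fun i => u ≤ τ (x i) ∧ τ (x i) ≤ τ (x k)).card) (c : ℝ) :
    |∑ i with u ≤ τ (x i) ∧ τ (x i) ≤ τ (x k), ((if y i ≤ c then 1 else 0) - G (x i) c)| ≤
      η * (Finset.univ.filter fun i => u ≤ τ (x i) ∧ τ (x i) ≤ τ (x k)).card := by
  by_contra hcon
  push Not at hcon
  -- By right-continuity in `c`, a strict violation persists just to the right of `c`, hence at a
  -- rational threshold.
  have hcont : ContinuousWithinAt (fun c => |∑ i with u ≤ τ (x i) ∧ τ (x i) ≤ τ (x k),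
      ((if y i ≤ c then 1 else 0) - G (x i) c)|) (Ici c) c :=
    ContinuousWithinAt.abs (tendsto_finsetSum _ fun i _ =>
      (continuousWithinAt_indicator_le (y i) c).sub ((hG (x i)).right_cont c))
  have hev := (hcont.mono Ioi_subset_Ici_self).eventually (lt_mem_nhds hcon)
  obtain ⟨d, hd, hd'⟩ := (mem_nhdsGT_iff_exists_Ioo_subset).1 hev
  obtain ⟨q, hq1, hq2⟩ := exists_rat_btwn (mem_Ioi.1 hd)
  exact h ⟨k, q, hk, hd' ⟨hq1, hq2⟩⟩

end Deviation

section Deterministic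

variable {n : ℕ} {G : ℝ → ℝ → ℝ} {S : Set ℝ} {x y : Fin n → ℝ} {h : ℝ → ℝ → ℝ}

lemma IsMonotoneLSE.sub_le_of_notMem (H : IsMonotoneLSE S x y h) (hx : ∀ i, x i ∈ S) {xo : ℝ}
    (hxo : xo ∈ S) (hG : ∀ t, IsDistFun (G t)) {c u L η q : ℝ} (hL : 0 < L)
    (hfreq : L ≤ freq x (Icc u xo)) (hdev : (x, y) ∉ blockDeviation n G id u L η)
    (hq : ∀ i, u ≤ x i → G (x i) c ≤ q) : h xo c - q ≤ η := by
  have hne : ∃ i, x i ∈ Icc u xo := by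
    by_contra hcon
    push Not at hcon
    have : freq x (Icc u xo) = 0 := by simp [freq_eq_card, hcon]
    rw [this] at hfreq
    norm_num at hfreq
    linarith
  obtain ⟨k, hk1, hk2⟩ := H.exists_block_ge hx hxo c u hne
  have hcard : L ≤ (Finset.univ.filter fun i => u ≤ x i ∧ x i ≤ x k).card :=
    hfreq.trans (Nat.cast_le.2 hk1)
  have hb := abs_sum_le_of_notMem_blockDeviation hG hdev k hcard c
  simp only [id] at hb
  have hb' := (le_abs_self _).trans hb
  rw [Finset.sum_sub_distrib] at hb'
  have hsum : ∑ i with u ≤ x i ∧ x i ≤ x k, G (x i) c ≤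
      (Finset.univ.filter fun i => u ≤ x i ∧ x i ≤ x k).card * q := by
    rw [← nsmul_eq_mul]
    exact Finset.sum_le_card_nsmul _ _ _ fun i hi => hq i (Finset.mem_filter.1 hi).2.1
  refine le_of_mul_le_mul_right ?_ (hL.trans_le hcard)
  linarith

lemma IsMonotoneLSE.le_sub_of_notMem (H : IsMonotoneLSE S x y h) (hx : ∀ i, x i ∈ S) {xo : ℝ}
    (hxo : xo ∈ S) (hG : ∀ t, IsDistFun (G t)) {c u L η q : ℝ} (hL : 0 < L)
    (hfreq : L ≤ freq x (Icc xo u)) (hdev : (x, y) ∉ blockDeviation n G (fun t => -t) (-u) L η)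
    (hq : ∀ i, x i ≤ u → q ≤ G (x i) c) : q - h xo c ≤ η := by
  have hne : ∃ i, x i ∈ Icc xo u := by
    by_contra hcon
    push Not at hcon
    have : freq x (Icc xo u) = 0 := by simp [freq_eq_card, hcon]
    rw [this] at hfreq
    norm_num at hfreq
    linarith
  obtain ⟨k, hk1, hk2⟩ := H.exists_block_le hx hxo c u hne
  have hcard : L ≤ (Finset.univ.filter fun i => -u ≤ -x i ∧ -x i ≤ -x k).card :=
    hfreq.trans (Nat.cast_le.2 hk1)
  have hb := abs_sum_le_of_notMem_blockDeviation hG hdev k hcard c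
  have hb' := (neg_abs_le _).trans' (neg_le_neg hb)
  rw [Finset.sum_sub_distrib] at hb'
  have hsum : (Finset.univ.filter fun i => -u ≤ -x i ∧ -x i ≤ -x k).card * q ≤
      ∑ i with -u ≤ -x i ∧ -x i ≤ -x k, G (x i) c := by
    rw [← nsmul_eq_mul]
    exact Finset.card_nsmul_le_sum _ _ _ fun i hi =>
      hq i (neg_le_neg_iff.1 (Finset.mem_filter.1 hi).2.1)
  refine le_of_mul_le_mul_right ?_ (hL.trans_le hcard)
  linarith

end Deterministic

/-! ### Measurability and rates -/

lemma measurable_freq_Icc {Ω : Type*} [MeasurableSpace Ω] {n : ℕ} {X : Fin n → Ω → ℝ}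
    (hX : ∀ i, Measurable (X i)) (a b : ℝ) :
    Measurable fun ω => (freq (fun i => X i ω) (Icc a b) : ℝ) := by
  classical
  simp_rw [freq_eq_card, Finset.card_eq_sum_ones, Nat.cast_sum, Finset.sum_filter]
  exact Finset.measurable_sum _ fun i _ =>
    Measurable.ite (hX i measurableSet_Icc) measurable_const measurable_const

lemma measurableSet_denseEvent {Ω : Type*} [MeasurableSpace Ω] {n : ℕ} {X : Fin n → Ω → ℝ}
    (hX : ∀ i, Measurable (X i)) (xo α C₂ C₃ : ℝ) : MeasurableSet (denseEvent X xo α C₂ C₃) :=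
  (measurableSet_le measurable_const ((measurable_freq_Icc hX _ _).div_const _)).inter
    (measurableSet_le measurable_const ((measurable_freq_Icc hX _ _).div_const _))

lemma measurable_of_antitoneOn_of_eq_const {S : Set ℝ} (hS : S.OrdConnected) {f : ℝ → ℝ} {b : ℝ}
    (hf : AntitoneOn f S) (hb : ∀ t ∉ S, f t = b) : Measurable f := by
  have := hS
  refine measurable_of_restrict_of_restrict_compl hS.measurableSet ?_ ?_
  · exact Antitone.measurable fun s t hst => hf s.2 t.2 hst
  · have : Sᶜ.domRestrict f = fun _ => b := funext fun t => hb t t.2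
    rw [this]
    exact measurable_const

lemma bandwidth_rpow {α C₃ : ℝ} (hC₃ : 0 < C₃) (n : ℕ) :
    bandwidth α C₃ n ^ α = C₃ ^ α * (n : ℝ) ^ (-α / (2 * α + 1)) := by
  rw [bandwidth, Real.mul_rpow hC₃.le (by positivity), ← Real.rpow_mul (Nat.cast_nonneg n)]
  congr 2
  ring

/-- The bias–variance balance: squared rate times local sample size does not depend on `n`. -/
lemma rate_sq_mul_bandwidth {α C₃ : ℝ} (hα : 0 < α) {n : ℕ} (hn : 0 < n) :
    ((n : ℝ) ^ (-α / (2 * α + 1))) ^ 2 * (n * bandwidth α C₃ n) = C₃ := by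
  have hn' : (0 : ℝ) < n := Nat.cast_pos.2 hn
  have h2 : (2 * α + 1) ≠ 0 := by positivity
  calc ((n : ℝ) ^ (-α / (2 * α + 1))) ^ 2 * (n * bandwidth α C₃ n)
      = C₃ * ((n : ℝ) ^ (-α / (2 * α + 1)) * (n : ℝ) ^ (-α / (2 * α + 1)) *
          ((n : ℝ) ^ (1 : ℝ) * (n : ℝ) ^ (-1 / (2 * α + 1)))) := by
        rw [bandwidth, Real.rpow_one]; ring
    _ = C₃ := by
        rw [← Real.rpow_add hn', ← Real.rpow_add hn', ← Real.rpow_add hn']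
        have : -α / (2 * α + 1) + -α / (2 * α + 1) + (1 + -1 / (2 * α + 1)) = 0 := by
          field_simp
          ring
        rw [this, Real.rpow_zero, mul_one]

lemma tendsto_bandwidth {α : ℝ} (hα : 0 < α) (C₃ : ℝ) :
    Tendsto (bandwidth α C₃) atTop (𝓝 0) := by
  have h1 : Tendsto (fun n : ℕ => (n : ℝ) ^ (-(1 / (2 * α + 1)))) atTop (𝓝 0) :=
    (tendsto_rpow_neg_atTop (by positivity)).comp tendsto_natCast_atTop_atTop
  have h2 := h1.const_mul C₃
  rw [mul_zero] at h2
  refine h2.congr fun n => ?_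
  rw [bandwidth, neg_div]

end
-- The rate of convergence
theorem theorem3
    -- the covariate interval, its interior point, and the true distribution functions
    (S : Set ℝ) (hS : S.OrdConnected) (xo : ℝ) (hxo : xo ∈ interior S)
    (F : ℝ → ℝ → ℝ) (hF : ∀ x ∈ S, IsDistFun (F x))
    (hFanti : ∀ y, AntitoneOn (fun x => F x y) S)
    -- the triangular scheme of observations
    {Ω : ℕ → Type*} [∀ n, MeasurableSpace (Ω n)]
    (μ : ∀ n, Measure (Ω n)) [∀ n, IsProbabilityMeasure (μ n)]
    (X Y : ∀ n, Fin n → Ω n → ℝ)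
    (hXY : ∀ n, 2 ≤ n → IsSample (μ n) S F (X n) (Y n))
    -- the estimator
    (Fhat : ∀ n, Ω n → ℝ → ℝ → ℝ)
    (hFhat : ∀ n, 2 ≤ n → ∀ ω,
      IsMonotoneLSE S (fun i => X n i ω) (fun i => Y n i ω) (Fhat n ω))
    -- local Hölder continuity at the point
    (U : Set ℝ) (hU : U ∈ 𝓝 xo) (hUS : U ⊆ S) (J : Set ℝ) (hJ : J.OrdConnected)
    (α : ℝ) (hα0 : 0 < α) (hα1 : α ≤ 1) (C₁ : ℝ) (hC₁ : 0 < C₁)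
    (hHolder : LocalHolder F xo U J α C₁)
    -- local density of the design points
    (C₂ C₃ : ℝ) (hC₂ : 0 < C₂) (hC₃ : 0 < C₃)
    (hDense : Tendsto (fun n => μ n (denseEvent (X n) xo α C₂ C₃)) atTop (𝓝 1)) :
    IsBigOInProb μ
      (fun n ω => ⨆ y ∈ J, ENNReal.ofReal |Fhat n ω xo y - F xo y|)
      (fun n => (n : ℝ) ^ (-α / (2 * α + 1))) := by
  classical
  have hxoS : xo ∈ S := interior_subset hxo
  -- The kernel needs a distribution function at every real `t`, measurably in `t`; the value off
  -- `S` is arbitrary.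
  let G : ℝ → ℝ → ℝ := fun t => if t ∈ S then F t else F xo
  have hGS : ∀ t ∈ S, F t = G t := fun t ht => (if_pos ht).symm
  have hG : ∀ t, IsDistFun (G t) := fun t => by
    by_cases ht : t ∈ S
    · rw [← hGS t ht]; exact hF t ht
    · simp only [G, if_neg ht]; exact hF xo hxoS
  have hGm : ∀ y, Measurable fun t => G t y := fun y =>
    measurable_of_antitoneOn_of_eq_const hS (b := F xo y)
      ((hFanti y).congr fun t ht => congrFun (hGS t ht) y) fun t ht => by simp [G, ht]
  intro ε hε
  -- Chosen so that each of the two deviation events has probability at most `ε / 4`: `1024 / (K ^ 2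
  -- * C₂ * C₃) = ε / 4`.
  set K : ℝ := √(4096 / (C₂ * C₃ * ε)) with hK
  have hKpos : 0 < K := Real.sqrt_pos.2 (by positivity)
  have hKsq : K ^ 2 = 4096 / (C₂ * C₃ * ε) := Real.sq_sqrt (by positivity)
  refine ⟨C₁ * C₃ ^ α + K, by positivity, ?_⟩
  have hdense_ev : ∀ᶠ n in atTop, 1 - ENNReal.ofReal (ε / 2) < μ n (denseEvent (X n) xo α C₂ C₃) :=
    hDense.eventually (lt_mem_nhds (ENNReal.sub_lt_self (by simp) (by simp) (by simpa using hε)))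
  obtain ⟨e, he, hball⟩ := Metric.mem_nhds_iff.1 hU
  have hband_ev : ∀ᶠ n in atTop, bandwidth α C₃ n < e :=
    (tendsto_bandwidth hα0 C₃).eventually (gt_mem_nhds he)
  filter_upwards [hdense_ev, hband_ev, eventually_ge_atTop 2] with n hdn hbn hn
  have hn0 : 0 < n := by omega
  have hn' : (0 : ℝ) < n := Nat.cast_pos.2 hn0
  set δ := bandwidth α C₃ n with hδ
  have hδpos : 0 < δ := mul_pos hC₃ (Real.rpow_pos_of_pos hn' _)
  set r : ℝ := (n : ℝ) ^ (-α / (2 * α + 1)) with hr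
  have hrpos : 0 < r := Real.rpow_pos_of_pos hn' _
  set L : ℝ := C₂ * (n * δ) with hL
  have hLpos : 0 < L := by positivity
  have hηL : 1024 / ((K * r) ^ 2 * L) = ε / 4 := by
    have : (K * r) ^ 2 * L = K ^ 2 * C₂ * (r ^ 2 * (n * δ)) := by rw [hL]; ring
    rw [this, rate_sq_mul_bandwidth hα0 hn0, hKsq]
    field_simp
    norm_num
  have hsample := hXY n hn
  set E₁ : Set (Ω n) := {ω | ((fun i => X n i ω), fun i => Y n i ω) ∈
    blockDeviation n G id (xo - δ) L (K * r)}
  set E₂ : Set (Ω n) := {ω | ((fun i => X n i ω), fun i => Y n i ω) ∈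
    blockDeviation n G (fun t => -t) (-(xo + δ)) L (K * r)}
  have hE₁ : μ n E₁ ≤ ENNReal.ofReal (ε / 4) := by
    rw [← hηL]
    exact hsample.measure_le_of_forall hG hGm hGS
      (measurableSet_blockDeviation hGm measurable_id _ _ _)
      (responseMeasure_blockDeviation_le hG _ _ hLpos (by positivity))
  have hE₂ : μ n E₂ ≤ ENNReal.ofReal (ε / 4) := by
    rw [← hηL]
    exact hsample.measure_le_of_forall hG hGm hGS
      (measurableSet_blockDeviation hGm measurable_neg _ _ _)
      (responseMeasure_blockDeviation_le hG _ _ hLpos (by positivity))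
  have hD : μ n (denseEvent (X n) xo α C₂ C₃)ᶜ ≤ ENNReal.ofReal (ε / 2) := by
    rw [prob_compl_eq_one_sub (measurableSet_denseEvent hsample.measurable_X _ _ _ _)]
    exact tsub_le_iff_tsub_le.1 hdn.le
  -- The left-hand event may be non-measurable; only monotonicity of the outer measure is used for
  -- it.
  have hsub : {ω | ENNReal.ofReal ((C₁ * C₃ ^ α + K) * r) <
      ⨆ y ∈ J, ENNReal.ofReal |Fhat n ω xo y - F xo y|} ⊆
      (denseEvent (X n) xo α C₂ C₃)ᶜ ∪ (E₁ ∪ E₂) := by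
    intro ω hω
    by_contra hcon
    simp only [mem_union, mem_compl_iff, not_or, not_not] at hcon
    obtain ⟨⟨hd1, hd2⟩, h1, h2⟩ := hcon
    rw [← hδ, le_div_iff₀ (by positivity)] at hd1 hd2
    refine absurd hω (not_lt.2 (iSup₂_le fun c hc => ENNReal.ofReal_le_ofReal ?_))
    have hlU : xo - δ ∈ U := hball (by
      rw [Metric.mem_ball, Real.dist_eq, sub_sub_cancel_left, abs_neg, abs_of_pos hδpos]
      exact hbn)
    have hrU : xo + δ ∈ U := hball (by
      rw [Metric.mem_ball, Real.dist_eq, add_sub_cancel_left, abs_of_pos hδpos]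
      exact hbn)
    have hl := hHolder _ hlU c hc
    have hr' := hHolder _ hrU c hc
    rw [sub_sub_cancel_left, abs_neg, abs_of_pos hδpos, hδ, bandwidth_rpow hC₃, ← hr] at hl
    rw [add_sub_cancel_left, abs_of_pos hδpos, hδ, bandwidth_rpow hC₃, ← hr] at hr'
    -- Points of the block may leave `U`; monotonicity compares them with `xo - δ`, so the Hölder
    -- bound is needed only at `xo - δ` and `xo + δ`.
    have hup := (hFhat n hn ω).sub_le_of_notMem (c := c) (q := F (xo - δ) c)
      (fun i => hsample.mem i ω) hxoS hG hLpos hd1 h1 fun i hi => by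
        rw [← hGS _ (hsample.mem i ω)]
        exact hFanti c (hUS hlU) (hsample.mem i ω) hi
    have hlo := (hFhat n hn ω).le_sub_of_notMem (c := c) (q := F (xo + δ) c)
      (fun i => hsample.mem i ω) hxoS hG hLpos hd2 h2 fun i hi => by
        rw [← hGS _ (hsample.mem i ω)]
        exact hFanti c (hsample.mem i ω) (hUS hrU) hi
    rw [abs_le]
    constructor
    · linarith [neg_abs_le (F (xo + δ) c - F xo c)]
    · linarith [le_abs_self (F (xo - δ) c - F xo c)]
  calc _ ≤ μ n ((denseEvent (X n) xo α C₂ C₃)ᶜ ∪ (E₁ ∪ E₂)) := measure_mono hsub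
    _ ≤ ENNReal.ofReal (ε / 2) + (ENNReal.ofReal (ε / 4) + ENNReal.ofReal (ε / 4)) :=
        (measure_union_le _ _).trans
          (add_le_add hD ((measure_union_le _ _).trans (add_le_add hE₁ hE₂)))
    _ = ENNReal.ofReal ε := by
        rw [← ENNReal.ofReal_add (by positivity) (by positivity),
          ← ENNReal.ofReal_add (by positivity) (by positivity)]
        congr 1
        ring
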